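/- Let $V$ be a finite-dimensional real inner product space with $\dim V\ge 2$, let $T>0$, and let $T((V))=\prod_{n\ge 0}V^{\otimes n}$ be the extended tensor algebra, with projections $\pi^{(n)}:T((V))\to T^{(n)}(V)=\prod_{i\le n}V^{\otimes i}$ and unit $\mathbf 1=(1,0,0,\dots)$. Let $G^{(\star)}\subset T((V))$ be the set of group-like elements, i.e. of all $g$ with constant term $1$ and $\Delta g=g\otimes g$, where $\Delta$ is the coproduct determined by multiplicativity and $\Delta v=v\otimes 1+1\otimes v$ for $v\in V$. Let $G^{(n)}=\pi^{(n)}(G^{(\star)})$ be the step-$n$ free nilpotent Lie group, equipped with the Carnot–Carathéodory metric. For real $p\ge 1$, let $C^{p\text{-var}}([0,T],G^{(n)})$ be the set of continuous paths of finite $p$-variation in $G^{(n)}$ that start at the unit; the elements of $C^{p\text{-var}}([0,T],G^{(\lfloor p\rfloor)})$ are the weakly geometric $p$-rough paths. The signature of such a path $\mathbb X$ is $\mathbb S_{0,T}(\mathbb X)\in G^{(\star)}$, where $t\mapsto \mathbb S_{0,t}(\mathbb X)$ is its Lyons lift: the unique path $[0,T]\to G^{(\star)}$ with $\mathbb S_{0,0}(\mathbb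 X)=\mathbf 1$, with $\pi^{(\lfloor p\rfloor)}(\mathbb S_{0,\cdot}(\mathbb X))=\mathbb X$, and with $\pi^{(n)}(\mathbb S_{0,\cdot}(\mathbb X))\in C^{p\text{-var}}([0,T],G^{(n)})$ for every $n$. Let $\mathscr S$ be the set of the signatures of all weakly geometric $p$-rough paths, for all real $p\ge 1$. Then $\mathscr S$ is a strict subset of $G^{(\star)}$. Moreover, if $G^{(\star)}$ carries the topology inherited from the product topology on $T((V))$, then $\mathscr S$ is a meagre subset of $G^{(\star)}$. -/

import Mathlib

namespace RoughPath

noncomputable section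

open Set Filter Topology MeasureTheory
open scoped ENNReal TensorProduct

/-- The tensor power `V^{⊗n}`, realised as the degree-`n` homogeneous part of the tensor algebra
of `V`, so that `⊗` is the multiplication of the tensor algebra. -/
abbrev TPow (V : Type*) [AddCommGroup V] [Module ℝ V] (n : ℕ) :
    Submodule ℝ (TensorAlgebra ℝ V) :=
  LinearMap.range (TensorAlgebra.ι ℝ : V →ₗ[ℝ] TensorAlgebra ℝ V) ^ n

/-- For finite-dimensional `V` the space `V^{⊗n}` is finite-dimensional, and the module topology is
its usual topology, the one defined by any norm. -/
instance TPow.instTopologicalSpace (V : Type*) [AddCommGroup V] [Module ℝ V] (n : ℕ) :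
    TopologicalSpace (TPow V n) :=
  moduleTopology ℝ (TPow V n)

/-- The extended tensor algebra `T((V)) = ∏ₙ V^{⊗n}`, with the product topology. -/
abbrev TensorSeries (V : Type*) [AddCommGroup V] [Module ℝ V] : Type _ :=
  (n : ℕ) → TPow V n

/-- The truncated tensor algebra `T^{(n)}(V) = ∏_{i ≤ n} V^{⊗i}`. -/
abbrev TruncTensor (V : Type*) [AddCommGroup V] [Module ℝ V] (n : ℕ) : Type _ :=
  (i : Fin (n + 1)) → TPow V i

/-- The projection `π^{(n)} : T((V)) → T^{(n)}(V)`. -/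
def trunc {V : Type*} [AddCommGroup V] [Module ℝ V] (n : ℕ) (g : TensorSeries V) :
    TruncTensor V n :=
  fun i => g i

/-- The unit `𝟏 = (1, 0, 0, …)` of `T((V))`. -/
def unitSeries (V : Type*) [AddCommGroup V] [Module ℝ V] : TensorSeries V
  | 0 => ⟨1, SetLike.one_mem_graded (TPow V)⟩
  | _ + 1 => 0

/-- The coproduct of the tensor algebra: the algebra homomorphism with
`Δ v = v ⊗ 1 + 1 ⊗ v` for `v ∈ V`. -/
def coproduct (V : Type*) [AddCommGroup V] [Module ℝ V] :
    TensorAlgebra ℝ V →ₐ[ℝ] TensorAlgebra ℝ V ⊗[ℝ] TensorAlgebra ℝ V :=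
  TensorAlgebra.lift ℝ
    ((Algebra.TensorProduct.includeLeft (R := ℝ) (S := ℝ) (A := TensorAlgebra ℝ V)
        (B := TensorAlgebra ℝ V)).toLinearMap ∘ₗ TensorAlgebra.ι ℝ +
      (Algebra.TensorProduct.includeRight (R := ℝ) (A := TensorAlgebra ℝ V)
        (B := TensorAlgebra ℝ V)).toLinearMap ∘ₗ TensorAlgebra.ι ℝ)

/-- The set `G^{(⋆)}` of group-like elements of `T((V))`: those `g` with constant term `1` and
`Δ g = g ⊗ g`, where the last identity is read off in every total degree `n`. -/
def groupLike (V : Type*) [AddCommGroup V] [Module ℝ V] : Set (TensorSeries V) :=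
  {g | (g 0 : TensorAlgebra ℝ V) = 1 ∧
    ∀ n : ℕ, coproduct V (g n) =
      ∑ ij ∈ Finset.HasAntidiagonal.antidiagonal n, (g ij.1 : TensorAlgebra ℝ V) ⊗ₜ[ℝ] (g ij.2 : TensorAlgebra ℝ V)}

/-- The step-`n` free nilpotent group `G^{(n)} = π^{(n)}(G^{(⋆)})`. -/
def truncGroup (V : Type*) [AddCommGroup V] [Module ℝ V] (n : ℕ) : Set (TruncTensor V n) :=
  trunc n '' groupLike V

/-- `Γ : [0,1] → T^{(n)}(V)` is a horizontal curve with control `u ∈ L¹([0,1], V)`: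
it solves `dΓ_t = Γ_t ⊗ u_t dt`, that is, `Γ_t = Γ_0 + ∫₀ᵗ Γ_s ⊗ u_s ds` in `T^{(n)}(V)`.
The integrals of functions with values in the finite-dimensional spaces `V^{⊗k}` are expressed
through all linear functionals `ℓ`. -/
structure IsHorizontal {V : Type*} [NormedAddCommGroup V] [InnerProductSpace ℝ V] (n : ℕ)
    (u : ℝ → V) (Γ : ℝ → TruncTensor V n) : Prop where
  integrable : IntegrableOn u (Icc 0 1)
  level_zero : ∀ t ∈ Icc (0 : ℝ) 1, Γ t 0 = Γ 0 0
  level_succ : ∀ (k : Fin n) (ℓ : Module.Dual ℝ (TensorAlgebra ℝ V)), ∀ t ∈ Icc (0 : ℝ) 1,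
    ℓ (Γ t k.succ) =
      ℓ (Γ 0 k.succ) +
        ∫ s in (0 : ℝ)..t, ℓ ((Γ s k.castSucc : TensorAlgebra ℝ V) * TensorAlgebra.ι ℝ (u s))

/-- The Carnot–Carathéodory distance on `G^{(n)}`: the infimum of the lengths `∫₀¹ ‖u_s‖ ds` of the
horizontal curves from `g` to `h`. -/
def ccDist {V : Type*} [NormedAddCommGroup V] [InnerProductSpace ℝ V] (n : ℕ)
    (g h : TruncTensor V n) : ℝ≥0∞ :=
  ⨅ (u : ℝ → V) (Γ : ℝ → TruncTensor V n) (_ : IsHorizontal n u Γ) (_ : Γ 0 = g) (_ : Γ 1 = h),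
    ∫⁻ s in Icc (0 : ℝ) 1, ‖u s‖ₑ

/-- The `p`-variation on `[0,T]` of a path in `G^{(n)}`, with respect to the Carnot–Carathéodory
distance; the supremum is over finite sequences `t_0 ≤ t_1 ≤ … ≤ t_m` in `[0,T]`. -/
def pVar {V : Type*} [NormedAddCommGroup V] [InnerProductSpace ℝ V] (p T : ℝ) (n : ℕ)
    (X : ℝ → TruncTensor V n) : ℝ≥0∞ :=
  (⨆ q : ℕ × {t : ℕ → ℝ // Monotone t ∧ ∀ i, t i ∈ Icc 0 T},
    ∑ i ∈ Finset.range q.1, ccDist n (X (q.2.1 i)) (X (q.2.1 (i + 1))) ^ p) ^ (1 / p)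

/-- Membership in `C^{p-var}([0,T], G^{(n)})`: paths with values in `G^{(n)}`, started at the unit,
continuous for the Carnot–Carathéodory metric and of finite `p`-variation.
Only the values of `X` on `[0,T]` matter. -/
structure IsPVarPath {V : Type*} [NormedAddCommGroup V] [InnerProductSpace ℝ V] (p T : ℝ) (n : ℕ)
    (X : ℝ → TruncTensor V n) : Prop where
  mem_group : ∀ t ∈ Icc 0 T, X t ∈ truncGroup V n
  start : X 0 = trunc n (unitSeries V)
  continuous : ∀ s ∈ Icc 0 T, Tendsto (fun t => ccDist n (X s) (X t)) (𝓝[Icc 0 T] s) (𝓝 0)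
  finite_pVar : pVar p T n X < ∞

/-- The space `WGΩ_p(V) = C^{p-var}([0,T], G^{(⌊p⌋)})` of weakly geometric rough paths. -/
def WeaklyGeometric (V : Type*) [NormedAddCommGroup V] [InnerProductSpace ℝ V] (p T : ℝ) :
    Set (ℝ → TruncTensor V ⌊p⌋₊) :=
  {X | IsPVarPath p T ⌊p⌋₊ X}

/-- `S` is the Lyons lift `t ↦ 𝕊_{0,t}(X)` of the weakly geometric `p`-rough path `X`: the path in
`G^{(⋆)}` started at the unit, of finite `p`-variation at every level, that extends `X`. -/
structure IsLyonsLift {V : Type*} [NormedAddCommGroup V] [InnerProductSpace ℝ V] (p T : ℝ)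
    (X : ℝ → TruncTensor V ⌊p⌋₊) (S : ℝ → TensorSeries V) : Prop where
  mem_groupLike : ∀ t ∈ Icc 0 T, S t ∈ groupLike V
  start : S 0 = unitSeries V
  isPVarPath : ∀ n : ℕ, IsPVarPath p T n (fun t => trunc n (S t))
  extends_path : ∀ t ∈ Icc 0 T, trunc ⌊p⌋₊ (S t) = X t

/-- The set `𝒮_p` of signatures `𝕊_{0,T}(X)` of weakly geometric `p`-rough paths `X`. -/
def signaturesOf (V : Type*) [NormedAddCommGroup V] [InnerProductSpace ℝ V] (p T : ℝ) :
    Set (TensorSeries V) :=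
  {g | ∃ X ∈ WeaklyGeometric V p T, ∃ S : ℝ → TensorSeries V, IsLyonsLift p T X S ∧ S T = g}

/-- The set `𝒮 = ⋃_{p ≥ 1} 𝒮_p` of all signatures. -/
def signatures (V : Type*) [NormedAddCommGroup V] [InnerProductSpace ℝ V] (T : ℝ) :
    Set (TensorSeries V) :=
  ⋃ (p : ℝ) (_ : 1 ≤ p), signaturesOf V p T

end

end RoughPath

/-!
Test a group-like series `g` against the words `a ⋯ a b` in two orthonormal letters: let `x` be
the coefficient of `a` and `Y = ∑ₖ yₖ Xᵏ` the generating series of the coefficients `yₖ` of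
`aᵏ b`. On group-like elements the pair `(x, Y)` is a homomorphism to the semidirect product
`ℝ ⋉ ℝ⟦X⟧` in which `x` acts by multiplication with `exp (x X)`, and the series
`exp (-x_g X) (Y_h - Y_g)` of `g⁻¹ ⊗ h` satisfies a Chen relation.

The coefficient of `Xᵏ` in it is bounded by the power `k + 1` of the Carnot–Carathéodory distance.
For the lift of a `p`-rough path this is a bound in terms of the control `w`, the `p`-th power of
the `p`-variation, and the sewing lemma propagates it from the degrees `k + 1 ≤ p` to all degrees,
with constants depending only on `p`: `|yₖ| ≤ C p k * w ^ ((k + 1) / p)`. Hence every signature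
lies in one of the countably many sets given by these bounds for natural `p` and `w`.

Each of these sets is closed, and it has empty interior: multiplying `g` by the exponential of a
multiple of the Lie element `[a, [a, … [a, b]]]` of degree `k + 1` gives `yₖ` any prescribed value
without changing the levels of degree at most `k`, and the product topology only sees finitely
many levels. Doing this successively in all degrees gives a group-like element outside all the
sets.
-/

namespace RoughPath

noncomputable section

open Set Filter Topology MeasureTheory
open scoped ENNReal TensorProduct
open PowerSeries (coeff rescale exp)

section Characters

variable {V : Type*} [AddCommGroup V] [Module ℝ V]

theorem mem_TPow_zero_iff {z : TensorAlgebra ℝ V} :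
    z ∈ TPow V 0 ↔ ∃ r : ℝ, algebraMap ℝ (TensorAlgebra ℝ V) r = z := by
  rw [TPow, pow_zero, Submodule.mem_one]

@[elab_as_elim]
theorem TPow_succ_induction {n : ℕ} {motive : TensorAlgebra ℝ V → Prop}
    (mul_ι : ∀ z ∈ TPow V n, ∀ v, motive (z * TensorAlgebra.ι ℝ v))
    (add : ∀ x y, motive x → motive y → motive (x + y))
    {z : TensorAlgebra ℝ V} (hz : z ∈ TPow V (n + 1)) : motive z := by
  rw [TPow, pow_succ] at hz
  refine Submodule.mul_induction_on hz ?_ add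
  rintro x hx _ ⟨v, rfl⟩
  exact mul_ι x hx v

variable {A : Type*} [CommRing A] [Algebra ℝ A]

theorem lift_smul_apply_of_mem_TPow (c : A) (f : V →ₗ[ℝ] A) {n : ℕ} {z : TensorAlgebra ℝ V}
    (hz : z ∈ TPow V n) :
    TensorAlgebra.lift ℝ (c • f) z = c ^ n * TensorAlgebra.lift ℝ f z := by
  induction n generalizing z with
  | zero =>
    obtain ⟨r, rfl⟩ := mem_TPow_zero_iff.1 hz
    simp only [AlgHom.commutes, pow_zero, one_mul]
  | succ n ih =>
    refine TPow_succ_induction (fun x hx v => ?_) (fun x y hx hy => ?_) hz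
    · simp only [map_mul, ih hx, TensorAlgebra.lift_ι_apply, LinearMap.smul_apply, smul_eq_mul]
      ring
    · simp only [map_add, hx, hy, mul_add]

theorem lift_add_apply (f f' : V →ₗ[ℝ] A) (z : TensorAlgebra ℝ V) :
    TensorAlgebra.lift ℝ (f + f') z =
      Algebra.TensorProduct.lift (TensorAlgebra.lift ℝ f) (TensorAlgebra.lift ℝ f')
        (fun _ _ => Commute.all _ _) (coproduct V z) := by
  have h : TensorAlgebra.lift ℝ (f + f') =
      (Algebra.TensorProduct.lift (TensorAlgebra.lift ℝ f) (TensorAlgebra.lift ℝ f')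
        (fun _ _ => Commute.all _ _)).comp (coproduct V) := by
    ext v
    simp [coproduct]
  exact DFunLike.congr_fun h z

theorem lift_linearMap_comp_apply (α : V →ₗ[ℝ] ℝ) (z : TensorAlgebra ℝ V) :
    TensorAlgebra.lift ℝ (Algebra.linearMap ℝ A ∘ₗ α) z =
      algebraMap ℝ A (TensorAlgebra.lift ℝ α z) := by
  have h : TensorAlgebra.lift ℝ (Algebra.linearMap ℝ A ∘ₗ α) =
      (Algebra.ofId ℝ A).comp (TensorAlgebra.lift ℝ α) := by
    ext v
    simp [Algebra.ofId_apply]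
  exact DFunLike.congr_fun h z

theorem lift_add_apply_of_mem_groupLike (f f' : V →ₗ[ℝ] A) {g : TensorSeries V}
    (hg : g ∈ groupLike V) (n : ℕ) :
    TensorAlgebra.lift ℝ (f + f') (g n) =
      ∑ ij ∈ Finset.HasAntidiagonal.antidiagonal n,
        TensorAlgebra.lift ℝ f (g ij.1) * TensorAlgebra.lift ℝ f' (g ij.2) := by
  simp only [lift_add_apply, hg.2 n, map_sum, Algebra.TensorProduct.lift_tmul]

theorem one_add_pow_mul_lift_apply_of_mem_groupLike (c : A) (f : V →ₗ[ℝ] A) {g : TensorSeries V}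
    (hg : g ∈ groupLike V) (n : ℕ) :
    (1 + c) ^ n * TensorAlgebra.lift ℝ f (g n) =
      ∑ ij ∈ Finset.HasAntidiagonal.antidiagonal n,
        TensorAlgebra.lift ℝ f (g ij.1) * (c ^ ij.2 * TensorAlgebra.lift ℝ f (g ij.2)) := by
  rw [← lift_smul_apply_of_mem_TPow _ f (g n).2, add_smul, one_smul,
    lift_add_apply_of_mem_groupLike f _ hg]
  simp only [fun i => lift_smul_apply_of_mem_TPow c f (g i).2]

variable (α : V →ₗ[ℝ] ℝ)

theorem succ_mul_lift_apply_of_mem_groupLike {g : TensorSeries V} (hg : g ∈ groupLike V) (n : ℕ) :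
    (n + 1) * TensorAlgebra.lift ℝ α (g (n + 1)) =
      TensorAlgebra.lift ℝ α (g n) * TensorAlgebra.lift ℝ α (g 1) := by
  -- Take `c = X` and compare the coefficients of `X`.
  have h := one_add_pow_mul_lift_apply_of_mem_groupLike Polynomial.X
    (Algebra.linearMap ℝ (Polynomial ℝ) ∘ₗ α) hg (n + 1)
  simp only [lift_linearMap_comp_apply, Polynomial.algebraMap_eq] at h
  have hcoeff := congrArg (Polynomial.coeff · 1) h
  simp only [Polynomial.finsetSum_coeff, Polynomial.coeff_mul_C, Polynomial.coeff_C_mul,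
    Polynomial.coeff_one_add_X_pow, Polynomial.coeff_X_pow, Nat.choose_one_right] at hcoeff
  rw [Finset.sum_eq_single (n, 1)] at hcoeff
  · simpa using hcoeff
  · rintro ⟨i, j⟩ hij hne
    have hj : 1 ≠ j := by
      rintro rfl
      exact hne (by simpa using hij)
    simp [hj]
  · intro h
    simp at h

theorem lift_apply_of_mem_groupLike {g : TensorSeries V} (hg : g ∈ groupLike V) (n : ℕ) :
    TensorAlgebra.lift ℝ α (g n) = TensorAlgebra.lift ℝ α (g 1) ^ n / n.factorial := by
  induction n with
  | zero => simp [hg.1]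
  | succ n ih =>
    have h := succ_mul_lift_apply_of_mem_groupLike α hg n
    rw [ih] at h
    rw [Nat.factorial_succ, pow_succ, eq_div_iff (by positivity)]
    push_cast
    field_simp at h
    linear_combination h

end Characters

section LastLetter

variable {V : Type*} [AddCommGroup V] [Module ℝ V]

/-- The representation of the tensor algebra extending `v ↦ !![α v, β v; 0, 0]`; it encodes the
pair of a character and a functional that treats the last letter of a word separately. -/
def matrixRep (α β : V →ₗ[ℝ] ℝ) : TensorAlgebra ℝ V →ₐ[ℝ] Matrix (Fin 2) (Fin 2) ℝ :=
  TensorAlgebra.lift ℝ (α.smulRight !![1, 0; 0, 0] + β.smulRight !![0, 1; 0, 0])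

/-- The functional `v₁ ⋯ vₙ₊₁ ↦ α v₁ ⋯ α vₙ * β vₙ₊₁`. If `α` and `β` are the coordinates dual to
two letters `a` and `b`, it reads off the coefficients of the words `a ⋯ a b`. -/
def lastLetter (α β : V →ₗ[ℝ] ℝ) : Module.Dual ℝ (TensorAlgebra ℝ V) :=
  Matrix.entryLinearMap ℝ ℝ 0 1 ∘ₗ (matrixRep α β).toLinearMap

variable (α β : V →ₗ[ℝ] ℝ)

theorem matrixRep_apply (z : TensorAlgebra ℝ V) :
    matrixRep α β z =
      !![TensorAlgebra.lift ℝ α z, lastLetter α β z; 0, TensorAlgebra.algebraMapInv z] := by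
  induction z using TensorAlgebra.induction with
  | algebraMap r =>
    ext i j
    fin_cases i <;> fin_cases j <;> simp [lastLetter, Matrix.algebraMap_matrix_apply]
  | ι v =>
    ext i j
    fin_cases i <;> fin_cases j <;> simp [lastLetter, matrixRep, TensorAlgebra.algebraMapInv]
  | add x y hx hy => simp [hx, hy]
  | mul x y hx hy =>
    have hlast : lastLetter α β (x * y) = (matrixRep α β x * matrixRep α β y) 0 1 := by
      rw [← map_mul]
      rfl
    rw [hlast, map_mul, map_mul, map_mul, hx, hy, Matrix.mul_fin_two]
    simp

theorem lastLetter_mul (x y : TensorAlgebra ℝ V) :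
    lastLetter α β (x * y) = TensorAlgebra.lift ℝ α x * lastLetter α β y +
      lastLetter α β x * TensorAlgebra.algebraMapInv y := by
  have h := congrArg (fun M => M 0 1) (map_mul (matrixRep α β) x y)
  simpa [matrixRep_apply, Matrix.mul_apply, Fin.sum_univ_two] using h

theorem lastLetter_ι (v : V) : lastLetter α β (TensorAlgebra.ι ℝ v) = β v := by
  simp [lastLetter, matrixRep]

theorem algebraMapInv_ι (v : V) :
    TensorAlgebra.algebraMapInv (TensorAlgebra.ι ℝ v) = (0 : ℝ) := by
  simp [TensorAlgebra.algebraMapInv]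

theorem lastLetter_mul_ι (z : TensorAlgebra ℝ V) (v : V) :
    lastLetter α β (z * TensorAlgebra.ι ℝ v) = TensorAlgebra.lift ℝ α z * β v := by
  rw [lastLetter_mul, lastLetter_ι, algebraMapInv_ι, mul_zero, add_zero]

theorem lastLetter_commutator {a : V} (haα : α a = 1) (haβ : β a = 0) (z : TensorAlgebra ℝ V) :
    lastLetter α β (TensorAlgebra.ι ℝ a * z - z * TensorAlgebra.ι ℝ a) = lastLetter α β z := by
  rw [map_sub, lastLetter_mul_ι, lastLetter_mul, lastLetter_ι, TensorAlgebra.lift_ι_apply, haα,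
    haβ]
  ring

theorem lastLetter_self_of_mem_TPow_succ {n : ℕ} {z : TensorAlgebra ℝ V}
    (hz : z ∈ TPow V (n + 1)) : lastLetter α α z = TensorAlgebra.lift ℝ α z := by
  refine TPow_succ_induction (fun x _ v => ?_) (fun x y hx hy => ?_) hz
  · rw [lastLetter_mul_ι, map_mul, TensorAlgebra.lift_ι_apply]
  · rw [map_add, map_add, hx, hy]

end LastLetter

section Increments

variable {V : Type*} [AddCommGroup V] [Module ℝ V] (α β : V →ₗ[ℝ] ℝ)

/-- The coordinate `g ↦ α g₁`. -/
def levelOne (g : TensorSeries V) : ℝ := TensorAlgebra.lift ℝ α (g 1)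

/-- The generating series of the coefficients of the words `a ⋯ a`, the letters being dual
to `α`. -/
def charSeries (g : TensorSeries V) : PowerSeries ℝ :=
  PowerSeries.mk fun k => TensorAlgebra.lift ℝ α (g k)

/-- The generating series of the coefficients of the words `a ⋯ a b`, the letters being dual
to `α` and `β`. -/
def lastLetterSeries (g : TensorSeries V) : PowerSeries ℝ :=
  PowerSeries.mk fun k => lastLetter α β (g (k + 1))

/-- For group-like `g` and `h`, the generating series of the coefficients of the words `a ⋯ a b` in
`g⁻¹ ⊗ h`; the formula makes sense without inverting `g`. -/
def increment (g h : TensorSeries V) : PowerSeries ℝ :=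
  rescale (-levelOne α g) (exp ℝ) * (lastLetterSeries α β h - lastLetterSeries α β g)

theorem coeff_rescale_exp (x : ℝ) (i : ℕ) : coeff i (rescale x (exp ℝ)) = x ^ i / i.factorial := by
  simp [PowerSeries.coeff_rescale, PowerSeries.coeff_exp, div_eq_mul_inv]

theorem rescale_exp_zero : rescale (0 : ℝ) (exp ℝ) = 1 := by
  simp

variable {α} in
theorem charSeries_of_mem_groupLike {g : TensorSeries V} (hg : g ∈ groupLike V) :
    charSeries α g = rescale (levelOne α g) (exp ℝ) := by
  ext n
  rw [charSeries, PowerSeries.coeff_mk, lift_apply_of_mem_groupLike α hg, coeff_rescale_exp,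
    levelOne]

theorem charSeries_eq_one_add_X_mul {g : TensorSeries V} (hg : (g 0 : TensorAlgebra ℝ V) = 1) :
    charSeries α g = 1 + PowerSeries.X * lastLetterSeries α α g := by
  ext n
  rcases n with _ | n
  · simp [charSeries, hg]
  · simp [charSeries, lastLetterSeries, PowerSeries.coeff_succ_X_mul, PowerSeries.coeff_one,
      lastLetter_self_of_mem_TPow_succ α (g (n + 1)).2]

variable {α} in
theorem rescale_exp_neg_mul_charSeries {g h : TensorSeries V} (hg : g ∈ groupLike V)
    (hh : (h 0 : TensorAlgebra ℝ V) = 1) :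
    rescale (-levelOne α g) (exp ℝ) * charSeries α h = 1 + PowerSeries.X * increment α α g h := by
  have hinv : rescale (-levelOne α g) (exp ℝ) * charSeries α g = 1 := by
    rw [charSeries_of_mem_groupLike hg, PowerSeries.exp_mul_exp_eq_exp_add, neg_add_cancel,
      rescale_exp_zero]
  rw [charSeries_eq_one_add_X_mul α hg.1] at hinv
  rw [charSeries_eq_one_add_X_mul α hh, increment]
  linear_combination hinv

theorem lastLetterSeries_sub (g h : TensorSeries V) :
    lastLetterSeries α β h - lastLetterSeries α β g =
      rescale (levelOne α g) (exp ℝ) * increment α β g h := by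
  rw [increment, ← mul_assoc, PowerSeries.exp_mul_exp_eq_exp_add, add_neg_cancel, rescale_exp_zero,
    one_mul]

theorem increment_self (g : TensorSeries V) : increment α β g g = 0 := by
  rw [increment, sub_self, mul_zero]

theorem coeff_zero_increment_self (g h : TensorSeries V) :
    coeff 0 (increment α α g h) = levelOne α h - levelOne α g := by
  have hlast : ∀ l : TensorSeries V, coeff 0 (lastLetterSeries α α l) = levelOne α l := fun l => by
    rw [lastLetterSeries, PowerSeries.coeff_mk, zero_add,
      lastLetter_self_of_mem_TPow_succ α (l 1).2, levelOne]
  rw [increment, PowerSeries.coeff_mul, Finset.Nat.antidiagonal_zero, Finset.sum_singleton,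
    coeff_rescale_exp, map_sub, hlast, hlast]
  simp

theorem increment_chen (g h l : TensorSeries V) :
    increment α β g l = increment α β g h +
      rescale (levelOne α h - levelOne α g) (exp ℝ) * increment α β h l := by
  have hexp : rescale (levelOne α h - levelOne α g) (exp ℝ) * rescale (-levelOne α h) (exp ℝ) =
      rescale (-levelOne α g) (exp ℝ) := by
    rw [PowerSeries.exp_mul_exp_eq_exp_add]
    congr 2
    ring
  simp only [increment]
  linear_combination -(lastLetterSeries α β l - lastLetterSeries α β h) * hexp

theorem coeff_increment_chen (g h l : TensorSeries V) (k : ℕ) :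
    coeff k (increment α β g l) =
      coeff k (increment α β g h) + coeff k (increment α β h l) +
        ∑ j ∈ Finset.range k, (levelOne α h - levelOne α g) ^ (k - j) / (k - j).factorial *
          coeff j (increment α β h l) := by
  rw [increment_chen α β g h l, map_add, mul_comm, PowerSeries.coeff_mul,
    Finset.Nat.sum_antidiagonal_eq_sum_range_succ_mk, Finset.sum_range_succ]
  simp only [coeff_rescale_exp, Nat.sub_self, pow_zero, Nat.factorial_zero, Nat.cast_one, div_one,
    mul_comm (coeff _ (increment α β h l))]
  ring

end Increments

section Horizontal

theorem coeff_mul_eq_integral {c D : PowerSeries ℝ} {F : ℝ → PowerSeries ℝ} {f : ℝ → ℝ} {r : ℝ}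
    {k : ℕ} (hint : ∀ j ≤ k, IntervalIntegrable (fun s => coeff j (F s) * f s) volume 0 r)
    (hD : ∀ j ≤ k, coeff j D = ∫ s in (0 : ℝ)..r, coeff j (F s) * f s) :
    coeff k (c * D) = ∫ s in (0 : ℝ)..r, coeff k (c * F s) * f s := by
  have hle : ∀ ij ∈ Finset.HasAntidiagonal.antidiagonal k, ij.2 ≤ k := fun ij hij =>
    Finset.HasAntidiagonal.antidiagonal.snd_le hij
  simp only [PowerSeries.coeff_mul, Finset.sum_mul, mul_assoc]
  rw [intervalIntegral.integral_finsetSum fun ij hij => (hint ij.2 (hle ij hij)).const_mul _]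
  refine Finset.sum_congr rfl fun ij hij => ?_
  rw [hD ij.2 (hle ij hij), intervalIntegral.integral_const_mul]

/-- The tensor series with vanishing levels above `n` that projects to `x`. -/
def zeroExtend {V : Type*} [AddCommGroup V] [Module ℝ V] {n : ℕ} (x : TruncTensor V n) :
    TensorSeries V :=
  fun i => if hi : i < n + 1 then x ⟨i, hi⟩ else 0

theorem zeroExtend_apply {V : Type*} [AddCommGroup V] [Module ℝ V] {n : ℕ} (x : TruncTensor V n)
    {i : ℕ} (hi : i < n + 1) : zeroExtend x i = x ⟨i, hi⟩ :=
  dif_pos hi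

theorem coeff_increment_zeroExtend_trunc {V : Type*} [AddCommGroup V] [Module ℝ V]
    (α β : V →ₗ[ℝ] ℝ) (g h : TensorSeries V) {k n : ℕ} (hk : k < n) :
    coeff k (increment α β g (zeroExtend (trunc n h))) = coeff k (increment α β g h) := by
  simp only [increment, PowerSeries.coeff_mul]
  refine Finset.sum_congr rfl fun ij hij => ?_
  have hj : ij.2 + 1 < n + 1 := by
    have := Finset.HasAntidiagonal.antidiagonal.snd_le hij
    omega
  simp only [map_sub, lastLetterSeries, PowerSeries.coeff_mk, zeroExtend_apply _ hj]
  rfl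

variable {V : Type*} [NormedAddCommGroup V] [InnerProductSpace ℝ V] {α β : V →ₗ[ℝ] ℝ}
  {n k : ℕ} {u : ℝ → V} {Γ : ℝ → TruncTensor V n} {g h : TensorSeries V}

theorem integrableOn_comp_of_abs_le_norm (hα : ∀ v, |α v| ≤ ‖v‖) {s : Set ℝ}
    (hu : IntegrableOn u s) : IntegrableOn (fun r => α (u r)) s :=
  (α.mkContinuous 1 fun v => by simpa using hα v).integrable_comp hu

omit [InnerProductSpace ℝ V] in
theorem ofReal_length (hu : IntegrableOn u (Icc 0 1)) :
    ENNReal.ofReal (∫ s in (0 : ℝ)..1, ‖u s‖) = ∫⁻ s in Icc (0 : ℝ) 1, ‖u s‖ₑ := by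
  rw [intervalIntegral.integral_of_le zero_le_one, ← integral_Icc_eq_integral_Ioc]
  exact ofReal_integral_norm_eq_lintegral_enorm hu

theorem IsHorizontal.zeroExtend_zero (hΓ : IsHorizontal n u Γ) (hg : g ∈ groupLike V)
    (hΓ0 : Γ 0 = trunc n g) {r : ℝ} (hr : r ∈ Icc (0 : ℝ) 1) :
    (zeroExtend (Γ r) 0 : TensorAlgebra ℝ V) = 1 := by
  rw [zeroExtend_apply _ n.succ_pos]
  refine (congrArg Subtype.val (hΓ.level_zero r hr)).trans ?_
  rw [hΓ0]
  exact hg.1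

theorem IsHorizontal.coeff_lastLetterSeries_sub (α β : V →ₗ[ℝ] ℝ) (hΓ : IsHorizontal n u Γ)
    (hΓ0 : Γ 0 = trunc n g) (hk : k < n) {r : ℝ} (hr : r ∈ Icc (0 : ℝ) 1) :
    coeff k (lastLetterSeries α β (zeroExtend (Γ r)) - lastLetterSeries α β g) =
      ∫ s in (0 : ℝ)..r, coeff k (charSeries α (zeroExtend (Γ s))) * β (u s) := by
  have hsucc := hΓ.level_succ ⟨k, hk⟩ (lastLetter α β) r hr
  simp only [lastLetter_mul_ι] at hsucc
  simp only [map_sub, lastLetterSeries, charSeries, PowerSeries.coeff_mk,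
    zeroExtend_apply _ (Nat.succ_lt_succ hk), zeroExtend_apply _ (hk.trans n.lt_succ_self)]
  rw [hΓ0] at hsucc
  exact sub_eq_iff_eq_add'.2 hsucc

theorem IsHorizontal.continuousOn_coeff_charSeries (hα : ∀ v, |α v| ≤ ‖v‖)
    (hΓ : IsHorizontal n u Γ) (hg : g ∈ groupLike V) (hΓ0 : Γ 0 = trunc n g) (hk : k ≤ n) :
    ContinuousOn (fun r => coeff k (charSeries α (zeroExtend (Γ r)))) (Icc 0 1) := by
  induction k with
  | zero =>
    refine (continuousOn_const (c := (1 : ℝ))).congr fun r hr => ?_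
    rw [charSeries, PowerSeries.coeff_mk, hΓ.zeroExtend_zero hg hΓ0 hr, map_one]
  | succ k ih =>
    have hint : IntegrableOn (fun s => coeff k (charSeries α (zeroExtend (Γ s))) * α (u s))
        (uIcc 0 1) := by
      rw [uIcc_of_le zero_le_one]
      exact (integrableOn_comp_of_abs_le_norm hα hΓ.integrable).continuousOn_mul
        (ih (k.le_succ.trans hk)) isCompact_Icc
    have hprim := intervalIntegral.continuousOn_primitive_interval hint
    rw [uIcc_of_le zero_le_one] at hprim
    refine ((continuousOn_const (c := coeff k (lastLetterSeries α α g))).add hprim).congr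
      fun r hr => ?_
    rw [charSeries_eq_one_add_X_mul α (hΓ.zeroExtend_zero hg hΓ0 hr), map_add,
      PowerSeries.coeff_succ_X_mul, PowerSeries.coeff_one, if_neg k.succ_ne_zero, zero_add,
      Pi.add_apply, ← hΓ.coeff_lastLetterSeries_sub α α hΓ0 hk hr, map_sub, add_sub_cancel]

theorem IsHorizontal.coeff_increment (hα : ∀ v, |α v| ≤ ‖v‖) (hβ : ∀ v, |β v| ≤ ‖v‖)
    (hΓ : IsHorizontal n u Γ) (hg : g ∈ groupLike V) (hΓ0 : Γ 0 = trunc n g) (hk : k < n)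
    {r : ℝ} (hr : r ∈ Icc (0 : ℝ) 1) :
    coeff k (increment α β g (zeroExtend (Γ r))) = ∫ s in (0 : ℝ)..r,
      coeff k (rescale (-levelOne α g) (exp ℝ) * charSeries α (zeroExtend (Γ s))) * β (u s) := by
  refine coeff_mul_eq_integral (fun j hj => ?_) fun j hj =>
    hΓ.coeff_lastLetterSeries_sub α β hΓ0 (hj.trans_lt hk) hr
  rw [intervalIntegrable_iff_integrableOn_Icc_of_le hr.1]
  exact ((integrableOn_comp_of_abs_le_norm hβ hΓ.integrable).continuousOn_mul
    (hΓ.continuousOn_coeff_charSeries hα hg hΓ0 (hj.trans hk.le)) isCompact_Icc).mono_set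
    (Icc_subset_Icc_right hr.2)

theorem abs_integral_mul_comp_le (hβ : ∀ v, |β v| ≤ ‖v‖) (hu : IntegrableOn u (Icc 0 1))
    {F : ℝ → ℝ} {M : ℝ} (hF : ∀ s ∈ Icc (0 : ℝ) 1, |F s| ≤ M) {r : ℝ} (hr : r ∈ Icc (0 : ℝ) 1) :
    |∫ s in (0 : ℝ)..r, F s * β (u s)| ≤ M * ∫ s in (0 : ℝ)..1, ‖u s‖ := by
  have hM : 0 ≤ M := (abs_nonneg _).trans (hF 0 (left_mem_Icc.2 zero_le_one))
  have hint : IntervalIntegrable (fun s => M * ‖u s‖) volume 0 1 :=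
    ((intervalIntegrable_iff_integrableOn_Icc_of_le zero_le_one).2 hu.norm).const_mul M
  calc |∫ s in (0 : ℝ)..r, F s * β (u s)|
      ≤ ∫ s in (0 : ℝ)..r, M * ‖u s‖ := by
        rw [← Real.norm_eq_abs]
        refine intervalIntegral.norm_integral_le_of_norm_le hr.1
          (Eventually.of_forall fun s hs => ?_) (hint.mono_set ?_)
        · rw [Real.norm_eq_abs, abs_mul]
          exact mul_le_mul (hF s ⟨hs.1.le, hs.2.trans hr.2⟩) (hβ _) (abs_nonneg _) hM
        · rw [uIcc_of_le hr.1, uIcc_of_le zero_le_one]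
          exact Icc_subset_Icc_right hr.2
    _ ≤ ∫ s in (0 : ℝ)..1, M * ‖u s‖ :=
        intervalIntegral.integral_mono_interval le_rfl hr.1 hr.2
          (Eventually.of_forall fun s => mul_nonneg hM (norm_nonneg _)) hint
    _ = M * ∫ s in (0 : ℝ)..1, ‖u s‖ := intervalIntegral.integral_const_mul _ _

theorem IsHorizontal.abs_coeff_increment_le (hα : ∀ v, |α v| ≤ ‖v‖) (hβ : ∀ v, |β v| ≤ ‖v‖)
    (hΓ : IsHorizontal n u Γ) (hg : g ∈ groupLike V) (hΓ0 : Γ 0 = trunc n g) (hk : k < n)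
    {r : ℝ} (hr : r ∈ Icc (0 : ℝ) 1) :
    |coeff k (increment α β g (zeroExtend (Γ r)))| ≤ (∫ s in (0 : ℝ)..1, ‖u s‖) ^ (k + 1) := by
  induction k generalizing β r with
  | zero =>
    rw [hΓ.coeff_increment hα hβ hg hΓ0 hk hr, pow_succ]
    refine abs_integral_mul_comp_le hβ hΓ.integrable (fun s hs => ?_) hr
    rw [rescale_exp_neg_mul_charSeries hg (hΓ.zeroExtend_zero hg hΓ0 hs)]
    simp
  | succ k ih =>
    rw [hΓ.coeff_increment hα hβ hg hΓ0 hk hr, pow_succ]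
    refine abs_integral_mul_comp_le hβ hΓ.integrable (fun s hs => ?_) hr
    rw [rescale_exp_neg_mul_charSeries hg (hΓ.zeroExtend_zero hg hΓ0 hs), map_add,
      PowerSeries.coeff_one, if_neg k.succ_ne_zero, zero_add, PowerSeries.coeff_succ_X_mul]
    exact ih hα (k.lt_succ_self.trans hk) hs

theorem ofReal_abs_coeff_increment_le (hα : ∀ v, |α v| ≤ ‖v‖) (hβ : ∀ v, |β v| ≤ ‖v‖)
    (hg : g ∈ groupLike V) (h : TensorSeries V) (hk : k < n) :
    ENNReal.ofReal |coeff k (increment α β g h)| ≤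
      ccDist n (trunc n g) (trunc n h) ^ (k + 1) := by
  have hk0 : (0 : ℝ) < (k + 1 : ℕ) := by positivity
  rw [← ENNReal.rpow_natCast, ← ENNReal.rpow_inv_le_iff hk0]
  refine le_iInf fun u => le_iInf fun Γ => le_iInf fun hΓ => le_iInf fun h0 => le_iInf fun h1 => ?_
  rw [ENNReal.rpow_inv_le_iff hk0, ENNReal.rpow_natCast, ← ofReal_length hΓ.integrable,
    ← ENNReal.ofReal_pow (intervalIntegral.integral_nonneg zero_le_one fun s _ => norm_nonneg _),
    ← coeff_increment_zeroExtend_trunc α β g h hk, ← h1]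
  exact ENNReal.ofReal_le_ofReal
    (hΓ.abs_coeff_increment_le hα hβ hg h0 hk (right_mem_Icc.2 zero_le_one))

theorem ofReal_abs_levelOne_sub_le (hα : ∀ v, |α v| ≤ ‖v‖) (hg : g ∈ groupLike V)
    (h : TensorSeries V) (hn : 0 < n) :
    ENNReal.ofReal |levelOne α h - levelOne α g| ≤ ccDist n (trunc n g) (trunc n h) := by
  simpa [coeff_zero_increment_self] using ofReal_abs_coeff_increment_le hα hα hg h hn

end Horizontal

section Sewing

/-- A control on `I`: a nonnegative superadditive function of two ordered times. Only its values
at ordered pairs of points of `I` matter. -/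
structure IsControlOn {ι : Type*} [Preorder ι] (ω : ι → ι → ℝ) (I : Set ι) : Prop where
  nonneg : ∀ s ∈ I, ∀ t ∈ I, s ≤ t → 0 ≤ ω s t
  superadditive : ∀ s ∈ I, ∀ t ∈ I, ∀ u ∈ I, s ≤ t → t ≤ u → ω s t + ω t u ≤ ω s u

namespace IsControlOn

variable {ι κ : Type*} [Preorder ι] [Preorder κ] {ω : ι → ι → ℝ} {I : Set ι}

theorem mono (hω : IsControlOn ω I) {J : Set ι} (hJ : J ⊆ I) : IsControlOn ω J where
  nonneg s hs t ht := hω.nonneg s (hJ hs) t (hJ ht)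
  superadditive s hs t ht u hu := hω.superadditive s (hJ hs) t (hJ ht) u (hJ hu)

theorem comp (hω : IsControlOn ω I) {τ : κ → ι} (hτ : Monotone τ) (hmem : ∀ i, τ i ∈ I) :
    IsControlOn (fun i j => ω (τ i) (τ j)) univ where
  nonneg i _ j _ hij := hω.nonneg _ (hmem i) _ (hmem j) (hτ hij)
  superadditive i _ j _ k _ hij hjk :=
    hω.superadditive _ (hmem i) _ (hmem j) _ (hmem k) (hτ hij) (hτ hjk)

theorem self_eq_zero (hω : IsControlOn ω I) {s : ι} (hs : s ∈ I) : ω s s = 0 :=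
  le_antisymm (by linarith [hω.superadditive s hs s hs s hs le_rfl le_rfl])
    (hω.nonneg s hs s hs le_rfl)

theorem left_le (hω : IsControlOn ω I) {s t u : ι} (hs : s ∈ I) (ht : t ∈ I) (hu : u ∈ I)
    (hst : s ≤ t) (htu : t ≤ u) : ω s t ≤ ω s u := by
  linarith [hω.superadditive s hs t ht u hu hst htu, hω.nonneg t ht u hu htu]

theorem right_le (hω : IsControlOn ω I) {s t u : ι} (hs : s ∈ I) (ht : t ∈ I) (hu : u ∈ I)
    (hst : s ≤ t) (htu : t ≤ u) : ω t u ≤ ω s u := by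
  linarith [hω.superadditive s hs t ht u hu hst htu, hω.nonneg s hs t ht hst]

theorem exists_le_half {ω : ℕ → ℕ → ℝ} (hω : IsControlOn ω univ) {i j : ℕ} (hij : i < j) :
    ∃ m, i ≤ m ∧ m < j ∧ ω i m ≤ ω i j / 2 ∧ ω (m + 1) j ≤ ω i j / 2 := by
  have hnonneg : 0 ≤ ω i j := hω.nonneg i trivial j trivial hij.le
  by_contra! hcon
  have hleft : ∀ m, i ≤ m → m < j → ω i m ≤ ω i j / 2 := by
    intro m him
    induction m, him using Nat.le_induction with
    | base => intro _; rw [hω.self_eq_zero trivial]; positivity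
    | succ m him ih =>
      intro hm
      have hright := hcon m him (by omega) (ih (by omega))
      linarith [hω.superadditive i trivial (m + 1) trivial j trivial (by omega) hm.le]
  have hright := hcon (j - 1) (by omega) (by omega) (hleft _ (by omega) (by omega))
  rw [Nat.sub_add_cancel (by omega : 1 ≤ j), hω.self_eq_zero trivial] at hright
  linarith

end IsControlOn

/-- The constant of the sewing lemma with exponent `θ > 1`; it solves
`c = 2 + c * 2 ^ (1 - θ)`. -/
def sewingConst (θ : ℝ) : ℝ := 2 / (1 - 2 ^ (1 - θ))

theorem one_sub_two_rpow_pos {θ : ℝ} (hθ : 1 < θ) : (0 : ℝ) < 1 - 2 ^ (1 - θ) :=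
  sub_pos.2 (Real.rpow_lt_one_of_one_lt_of_neg one_lt_two (by linarith))

theorem sewingConst_nonneg {θ : ℝ} (hθ : 1 < θ) : 0 ≤ sewingConst θ :=
  div_nonneg zero_le_two (one_sub_two_rpow_pos hθ).le

theorem sewingConst_eq {θ : ℝ} (hθ : 1 < θ) :
    sewingConst θ = 2 + sewingConst θ * 2 ^ (1 - θ) := by
  have : sewingConst θ * (1 - 2 ^ (1 - θ)) = 2 := div_mul_cancel₀ _ (one_sub_two_rpow_pos hθ).ne'
  linarith

theorem sewingConst_mul_rpow {θ : ℝ} (hθ : 1 < θ) {x : ℝ} (hx : 0 ≤ x) :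
    sewingConst θ * x ^ θ = 2 * x ^ θ + 2 * (sewingConst θ * (x / 2) ^ θ) := by
  have hhalf : 2 * (x / 2) ^ θ = 2 ^ (1 - θ) * x ^ θ := by
    rw [Real.div_rpow hx zero_le_two, Real.rpow_sub two_pos, Real.rpow_one]
    ring
  linear_combination x ^ θ * sewingConst_eq hθ - sewingConst θ * hhalf

variable {E : Type*} [SeminormedAddCommGroup E]

theorem discrete_sewing {ω : ℕ → ℕ → ℝ} {y : ℕ → ℕ → E} {K θ : ℝ} (hθ : 1 < θ) (hK : 0 ≤ K)
    (hω : IsControlOn ω univ)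
    (hy : ∀ i j k, i ≤ j → j ≤ k → ‖y i k - y i j - y j k‖ ≤ K * ω i k ^ θ)
    (hself : ∀ i, y i i = 0) {i j : ℕ} (hij : i ≤ j) :
    ‖y i j - ∑ l ∈ Finset.Ico i j, y l (l + 1)‖ ≤ K * (sewingConst θ * ω i j ^ θ) := by
  induction hn : j - i using Nat.strong_induction_on generalizing i j with
  | _ n ih =>
    have hnonneg : 0 ≤ ω i j := hω.nonneg i trivial j trivial hij
    rcases hij.eq_or_lt with rfl | hlt
    · have := mul_nonneg (sewingConst_nonneg hθ) (Real.rpow_nonneg hnonneg θ)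
      simpa [hself] using mul_nonneg hK this
    obtain ⟨m, him, hmj, hleft, hright⟩ := hω.exists_le_half hlt
    have hhalf : ∀ {i' j'}, i' ≤ j' → ω i' j' ≤ ω i j / 2 → j' - i' < n →
        ‖y i' j' - ∑ l ∈ Finset.Ico i' j', y l (l + 1)‖ ≤
          K * (sewingConst θ * (ω i j / 2) ^ θ) := fun {i' j'} hij' hle hlt' =>
      (ih _ hlt' hij' rfl).trans <| mul_le_mul_of_nonneg_left (mul_le_mul_of_nonneg_left
        (Real.rpow_le_rpow (hω.nonneg _ trivial _ trivial hij') hle (by linarith))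
        (sewingConst_nonneg hθ)) hK
    have hdefect : ‖y m j - y m (m + 1) - y (m + 1) j‖ ≤ K * ω i j ^ θ :=
      (hy m (m + 1) j m.le_succ hmj).trans <| mul_le_mul_of_nonneg_left
        (Real.rpow_le_rpow (hω.nonneg m trivial j trivial hmj.le)
          (hω.right_le trivial trivial trivial him hmj.le) (by linarith)) hK
    have hsplit : y i j - ∑ l ∈ Finset.Ico i j, y l (l + 1) =
        (y i j - y i m - y m j) + (y m j - y m (m + 1) - y (m + 1) j) +
          (y i m - ∑ l ∈ Finset.Ico i m, y l (l + 1)) +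
          (y (m + 1) j - ∑ l ∈ Finset.Ico (m + 1) j, y l (l + 1)) := by
      rw [← Finset.sum_Ico_consecutive _ him hmj.le, Finset.sum_eq_sum_Ico_succ_bot hmj]
      abel
    rw [hsplit, sewingConst_mul_rpow hθ hnonneg]
    refine (norm_add₄_le ..).trans ?_
    linarith [hy i m j him hmj.le, hhalf him hleft (by omega), hhalf hmj hright (by omega)]

/-- `Y` has arbitrarily small sums over the partitions of `[s, t]`. -/
def HasSmallPartitionSums {ι : Type*} [Preorder ι] (Y : ι → ι → E) (s t : ι) : Prop :=
  ∀ ε > 0, ∃ (τ : ℕ → ι) (m : ℕ), Monotone τ ∧ (∀ i, τ i ∈ Icc s t) ∧ τ 0 = s ∧ τ m = t ∧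
    ∑ i ∈ Finset.range m, ‖Y (τ i) (τ (i + 1))‖ ≤ ε

theorem sewing {ι : Type*} [Preorder ι] {ω : ι → ι → ℝ} {Y : ι → ι → E} {K θ : ℝ} {s t : ι}
    (hθ : 1 < θ) (hK : 0 ≤ K) (hω : IsControlOn ω (Icc s t))
    (hY : ∀ a ∈ Icc s t, ∀ b ∈ Icc s t, ∀ c ∈ Icc s t, a ≤ b → b ≤ c →
      ‖Y a c - Y a b - Y b c‖ ≤ K * ω a c ^ θ)
    (hself : ∀ a, Y a a = 0) (hsmall : HasSmallPartitionSums Y s t) :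
    ‖Y s t‖ ≤ K * (sewingConst θ * ω s t ^ θ) := by
  refine le_of_forall_pos_le_add fun ε hε => ?_
  obtain ⟨τ, m, hτ, hmem, hzero, hm, hsum⟩ := hsmall ε hε
  have hsew := discrete_sewing (y := fun i j => Y (τ i) (τ j)) hθ hK (hω.comp hτ hmem)
    (fun i j k hij hjk => hY _ (hmem i) _ (hmem j) _ (hmem k) (hτ hij) (hτ hjk))
    (fun i => hself _) m.zero_le
  simp only [hzero, hm, Nat.Ico_zero_eq_range] at hsew
  calc ‖Y s t‖
      ≤ ‖Y s t - ∑ i ∈ Finset.range m, Y (τ i) (τ (i + 1))‖ +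
          ‖∑ i ∈ Finset.range m, Y (τ i) (τ (i + 1))‖ := norm_le_norm_sub_add _ _
    _ ≤ K * (sewingConst θ * ω s t ^ θ) + ε := add_le_add hsew ((norm_sum_le _ _).trans hsum)

theorem exists_partition_dist_le {s t δ : ℝ} (hst : s ≤ t) (hδ : 0 < δ) :
    ∃ (τ : ℕ → ℝ) (m : ℕ), Monotone τ ∧ (∀ i, τ i ∈ Icc s t) ∧ τ 0 = s ∧ τ m = t ∧
      ∀ i, |τ (i + 1) - τ i| ≤ δ := by
  obtain ⟨m, hm⟩ := Set.Icc.addNSMul_eq_right hst hδ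
  refine ⟨fun i => Set.Icc.addNSMul hst δ i, m,
    fun i j hij => Set.Icc.monotone_addNSMul hst hδ.le hij, fun i => Subtype.coe_prop _,
    Set.Icc.addNSMul_zero hst, hm m le_rfl, fun i => ?_⟩
  exact Set.Icc.abs_sub_addNSMul_le hst hδ.le i
    (right_mem_Icc.2 (Set.Icc.monotone_addNSMul hst hδ.le i.le_succ))

theorem le_rpow_mul_rpow {x η q : ℝ} (hx : 0 ≤ x) (hxη : x ≤ η) (hq : q < 1) :
    x ≤ η ^ (1 - q) * x ^ q := by
  calc x = x ^ (1 - q) * x ^ q := by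
        rw [← Real.rpow_add' hx (by simp), sub_add_cancel, Real.rpow_one]
    _ ≤ η ^ (1 - q) * x ^ q := by gcongr

theorem hasSmallPartitionSums_of_sum_rpow_le {Y : ℝ → ℝ → E} {s t q W : ℝ} (hst : s ≤ t)
    (hq : q < 1) (hY : ContinuousOn (fun z : ℝ × ℝ => Y z.1 z.2) (Icc s t ×ˢ Icc s t))
    (hself : ∀ a, Y a a = 0)
    (hvar : ∀ (τ : ℕ → ℝ) (m : ℕ), Monotone τ → (∀ i, τ i ∈ Icc s t) →
      ∑ i ∈ Finset.range m, ‖Y (τ i) (τ (i + 1))‖ ^ q ≤ W) :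
    HasSmallPartitionSums Y s t := by
  intro ε hε
  have hW : 0 ≤ W := by
    simpa using hvar (fun _ => s) 0 monotone_const (fun _ => left_mem_Icc.2 hst)
  obtain ⟨η, hη, hηε⟩ : ∃ η > 0, η ^ (1 - q) * W ≤ ε := by
    refine ⟨(ε / (W + 1)) ^ (1 - q)⁻¹, by positivity, ?_⟩
    rw [Real.rpow_inv_rpow (by positivity) (by linarith), div_mul_eq_mul_div,
      div_le_iff₀ (by positivity)]
    nlinarith
  obtain ⟨δ, hδ, hYδ⟩ := Metric.uniformContinuousOn_iff_le.1
    ((isCompact_Icc.prod isCompact_Icc).uniformContinuousOn_of_continuous hY) η hη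
  obtain ⟨τ, m, hτ, hmem, hzero, hm, hstep⟩ := exists_partition_dist_le hst hδ
  have hsmall : ∀ i, ‖Y (τ i) (τ (i + 1))‖ ≤ η := fun i => by
    have hdist : dist (τ i, τ (i + 1)) (τ i, τ i) ≤ δ := by
      rw [Prod.dist_eq, dist_self, Real.dist_eq]
      exact max_le hδ.le (hstep i)
    simpa [hself] using hYδ _ ⟨hmem i, hmem (i + 1)⟩ _ ⟨hmem i, hmem i⟩ hdist
  refine ⟨τ, m, hτ, hmem, hzero, hm, ?_⟩
  calc ∑ i ∈ Finset.range m, ‖Y (τ i) (τ (i + 1))‖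
      ≤ ∑ i ∈ Finset.range m, η ^ (1 - q) * ‖Y (τ i) (τ (i + 1))‖ ^ q :=
        Finset.sum_le_sum fun i _ => le_rpow_mul_rpow (norm_nonneg _) (hsmall i) hq
    _ = η ^ (1 - q) * ∑ i ∈ Finset.range m, ‖Y (τ i) (τ (i + 1))‖ ^ q :=
        (Finset.mul_sum _ _ _).symm
    _ ≤ η ^ (1 - q) * W := mul_le_mul_of_nonneg_left (hvar τ m hτ hmem) (by positivity)
    _ ≤ ε := hηε

end Sewing

section Control

variable {ι : Type*} [Preorder ι]

/-- The supremum of the sums of `d` over finite increasing sequences in `[s, t]`: for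
`d a b = dist (x a) (x b) ^ p` it is the `p`-th power of the `p`-variation of `x` on `[s, t]`. -/
def control (d : ι → ι → ℝ≥0∞) (s t : ι) : ℝ≥0∞ :=
  ⨆ q : ℕ × {τ : ℕ → ι // Monotone τ ∧ ∀ i, τ i ∈ Icc s t},
    ∑ i ∈ Finset.range q.1, d (q.2.1 i) (q.2.1 (i + 1))

variable (d : ι → ι → ℝ≥0∞) {s t u : ι}

theorem sum_le_control {τ : ℕ → ι} (hτ : Monotone τ) (hmem : ∀ i, τ i ∈ Icc s t) (m : ℕ) :
    ∑ i ∈ Finset.range m, d (τ i) (τ (i + 1)) ≤ control d s t :=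
  le_iSup (fun q : ℕ × {τ : ℕ → ι // Monotone τ ∧ ∀ i, τ i ∈ Icc s t} =>
    ∑ i ∈ Finset.range q.1, d (q.2.1 i) (q.2.1 (i + 1))) (m, ⟨τ, hτ, hmem⟩)

theorem le_control (hst : s ≤ t) : d s t ≤ control d s t := by
  have h := sum_le_control d (s := s) (t := t) (τ := fun i => if i = 0 then s else t)
    (monotone_nat_of_le_succ fun i => by rcases i with _ | i <;> simp [hst])
    (fun i => by split_ifs <;> simp [hst]) 1
  simpa using h

theorem control_mono {s' t' : ι} (hs : s' ≤ s) (ht : t ≤ t') : control d s t ≤ control d s' t' :=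
  iSup_le fun q => sum_le_control d q.2.2.1 (fun i => Icc_subset_Icc hs ht (q.2.2.2 i)) q.1

theorem control_add_le (hst : s ≤ t) (htu : t ≤ u) :
    control d s t + control d t u ≤ control d s u := by
  have : Nonempty {τ : ℕ → ι // Monotone τ ∧ ∀ i, τ i ∈ Icc s t} :=
    ⟨⟨fun _ => s, monotone_const, fun _ => ⟨le_rfl, hst⟩⟩⟩
  have : Nonempty {τ : ℕ → ι // Monotone τ ∧ ∀ i, τ i ∈ Icc t u} :=
    ⟨⟨fun _ => t, monotone_const, fun _ => ⟨le_rfl, htu⟩⟩⟩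
  refine ENNReal.iSup_add_iSup_le ?_
  rintro ⟨m, τ, hτ, hτmem⟩ ⟨m', τ', hτ', hτmem'⟩
  let σ : ℕ → ι := fun i => if i ≤ m then τ i else τ' (i - (m + 1))
  have hleft : ∀ i ≤ m, σ i = τ i := fun i hi => if_pos hi
  have hright : ∀ i, σ (m + 1 + i) = τ' i := fun i => by
    simp only [σ, if_neg (show ¬ m + 1 + i ≤ m by omega), Nat.add_sub_cancel_left]
  have hσ : Monotone σ := by
    refine monotone_nat_of_le_succ fun i => ?_
    dsimp only [σ]
    split_ifs
    · exact hτ i.le_succ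
    · exact (hτmem i).2.trans (hτmem' _).1
    · omega
    · exact hτ' (by omega)
  have hσmem : ∀ i, σ i ∈ Icc s u := fun i => by
    dsimp only [σ]
    split_ifs
    · exact ⟨(hτmem i).1, (hτmem i).2.trans htu⟩
    · exact ⟨hst.trans (hτmem' _).1, (hτmem' _).2⟩
  refine le_trans ?_ (sum_le_control d hσ hσmem (m + 1 + m'))
  rw [Finset.sum_range_add, Finset.sum_range_succ]
  refine add_le_add (le_add_right (Finset.sum_le_sum fun i hi => ?_))
    (Finset.sum_le_sum fun i _ => ?_)
  · have := Finset.mem_range.1 hi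
    rw [hleft i this.le, hleft (i + 1) this]
  · rw [add_assoc (m + 1), hright, hright]

variable {d} in
theorem isControlOn_toReal_control (hd : control d s t < ∞) :
    IsControlOn (fun a b => (control d a b).toReal) (Icc s t) where
  nonneg _ _ _ _ _ := ENNReal.toReal_nonneg
  superadditive a ha b _ c hc hab hbc := by
    have hfin : control d a c ≠ ∞ := ((control_mono d ha.1 hc.2).trans_lt hd).ne
    have hadd := control_add_le d hab hbc
    have hsum : control d a b + control d b c ≠ ∞ := (hadd.trans_lt hfin.lt_top).ne
    rw [← ENNReal.toReal_add (ne_top_of_le_ne_top hsum le_self_add)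
      (ne_top_of_le_ne_top hsum le_add_self)]
    exact ENNReal.toReal_mono hfin hadd

variable {d} in
theorem control_rpow_lt_top {p q : ℝ} (hp : 0 < p) (hpq : p ≤ q)
    (hd : control (fun a b => d a b ^ p) s t < ∞) : control (fun a b => d a b ^ q) s t < ∞ := by
  set W := control (fun a b => d a b ^ p) s t
  have hr : 0 ≤ (q - p) / p := div_nonneg (sub_nonneg.2 hpq) hp.le
  have hpow : ∀ a ∈ Icc s t, ∀ b ∈ Icc s t, a ≤ b →
      d a b ^ q ≤ W ^ ((q - p) / p) * d a b ^ p := fun a ha b hb hab => by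
    have hW : d a b ^ p ≤ W :=
      (le_control (fun a b => d a b ^ p) hab).trans (control_mono _ ha.1 hb.2)
    calc d a b ^ q = (d a b ^ p) ^ ((q - p) / p) * d a b ^ p := by
          rw [← ENNReal.rpow_mul, mul_div_cancel₀ _ hp.ne',
            ← ENNReal.rpow_add_of_nonneg _ _ (sub_nonneg.2 hpq) hp.le, sub_add_cancel]
      _ ≤ W ^ ((q - p) / p) * d a b ^ p := by gcongr
  have hle : control (fun a b => d a b ^ q) s t ≤ W ^ ((q - p) / p) * W := by
    refine iSup_le fun ⟨m, τ, hτ, hmem⟩ => ?_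
    calc ∑ i ∈ Finset.range m, d (τ i) (τ (i + 1)) ^ q
        ≤ ∑ i ∈ Finset.range m, W ^ ((q - p) / p) * d (τ i) (τ (i + 1)) ^ p :=
          Finset.sum_le_sum fun i _ => hpow _ (hmem i) _ (hmem (i + 1)) (hτ i.le_succ)
      _ = W ^ ((q - p) / p) * ∑ i ∈ Finset.range m, d (τ i) (τ (i + 1)) ^ p :=
          (Finset.mul_sum _ _ _).symm
      _ ≤ W ^ ((q - p) / p) * W := by
          gcongr
          exact sum_le_control (fun a b => d a b ^ p) hτ hmem m
  exact hle.trans_lt (ENNReal.mul_lt_top (ENNReal.rpow_lt_top_of_nonneg hr hd.ne) hd)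

theorem le_toReal_rpow_div {y p : ℝ} {d c : ℝ≥0∞} {m : ℕ} (hp : 0 < p)
    (hy : ENNReal.ofReal y ≤ d ^ m) (hd : d ^ p ≤ c) (hc : c ≠ ∞) :
    y ≤ c.toReal ^ ((m : ℝ) / p) := by
  have hm : 0 ≤ (m : ℝ) / p := by positivity
  rw [ENNReal.toReal_rpow, ← ENNReal.ofReal_le_iff_le_toReal
    (ENNReal.rpow_lt_top_of_nonneg hm hc).ne]
  calc ENNReal.ofReal y ≤ d ^ m := hy
    _ = (d ^ p) ^ ((m : ℝ) / p) := by
      rw [← ENNReal.rpow_mul, mul_div_cancel₀ _ hp.ne', ENNReal.rpow_natCast]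
    _ ≤ c ^ ((m : ℝ) / p) := ENNReal.rpow_le_rpow hd hm

end Control

section Lift

/-- The increments of the path `S` have the regularity of a path of finite `p`-variation controlled
by `ω`, in the sense of rough paths: bounds in the degrees at most `p`, and small sums over
partitions in the degrees above `p`, where the bounds are to be proved. The coefficient of index `k`
of an increment has degree `k + 1`. -/
structure IsControlled {V ι : Type*} [AddCommGroup V] [Module ℝ V] [Preorder ι] (α β : V →ₗ[ℝ] ℝ)
    (p : ℝ) (ω : ι → ι → ℝ) (I : Set ι) (S : ι → TensorSeries V) : Prop where
  isControlOn : IsControlOn ω I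
  levelOne_le : ∀ s ∈ I, ∀ t ∈ I, s ≤ t →
    |levelOne α (S t) - levelOne α (S s)| ≤ ω s t ^ (1 / p)
  increment_le : ∀ k : ℕ, k + 1 ≤ p → ∀ s ∈ I, ∀ t ∈ I, s ≤ t →
    |coeff k (increment α β (S s) (S t))| ≤ ω s t ^ ((k + 1) / p)
  small_sums : ∀ k : ℕ, p < k + 1 → ∀ s ∈ I, ∀ t ∈ I, s ≤ t →
    HasSmallPartitionSums (fun a b => coeff k (increment α β (S a) (S b))) s t

theorem abs_chen_defect_le {V : Type*} [AddCommGroup V] [Module ℝ V] {α β : V →ₗ[ℝ] ℝ}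
    {g h l : TensorSeries V} {k : ℕ} {p w : ℝ} {C : ℕ → ℝ} (hp : 0 < p) (hw : 0 ≤ w)
    (hx : |levelOne α h - levelOne α g| ≤ w ^ (1 / p))
    (hy : ∀ j < k, |coeff j (increment α β h l)| ≤ C j * w ^ ((j + 1) / p)) :
    |coeff k (increment α β g l) - coeff k (increment α β g h) - coeff k (increment α β h l)| ≤
      (∑ j ∈ Finset.range k, C j) * w ^ ((k + 1) / p) := by
  rw [coeff_increment_chen, sub_sub, add_sub_cancel_left, Finset.sum_mul]
  refine (Finset.abs_sum_le_sum_abs _ _).trans (Finset.sum_le_sum fun j hj => ?_)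
  have hjk : j < k := Finset.mem_range.1 hj
  have hfactor : |(levelOne α h - levelOne α g) ^ (k - j) / (k - j).factorial| ≤
      w ^ ((k - j) / p) := by
    rw [abs_div, abs_pow, Nat.abs_cast]
    calc |levelOne α h - levelOne α g| ^ (k - j) / (k - j).factorial
        ≤ |levelOne α h - levelOne α g| ^ (k - j) :=
          div_le_self (by positivity) (by exact_mod_cast Nat.factorial_pos (k - j))
      _ ≤ (w ^ (1 / p)) ^ (k - j) := pow_le_pow_left₀ (abs_nonneg _) hx _
      _ = w ^ ((k - j) / p) := by
        rw [← Real.rpow_mul_natCast hw, Nat.cast_sub hjk.le]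
        ring_nf
  calc |(levelOne α h - levelOne α g) ^ (k - j) / (k - j).factorial *
        coeff j (increment α β h l)|
      ≤ w ^ ((k - j) / p) * (C j * w ^ ((j + 1) / p)) := by
        rw [abs_mul]
        exact mul_le_mul hfactor (hy j hjk) (abs_nonneg _) (by positivity)
    _ = C j * w ^ ((k + 1) / p) := by
        have hexp : (k + 1) / p = (k - j) / p + (j + 1) / p := by ring
        have hkj : (0 : ℝ) ≤ k - j := sub_nonneg.2 (by exact_mod_cast hjk.le)
        rw [hexp, Real.rpow_add_of_nonneg hw (by positivity) (by positivity)]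
        ring

theorem exists_coeff_increment_bound {V ι : Type*} [AddCommGroup V] [Module ℝ V] [Preorder ι]
    (α β : V →ₗ[ℝ] ℝ) {p : ℝ} (hp : 0 < p) (k : ℕ) :
    ∃ C ≥ 0, ∀ (ω : ι → ι → ℝ) (a b : ι) (S : ι → TensorSeries V),
      IsControlled α β p ω (Icc a b) S → ∀ s ∈ Icc a b, ∀ t ∈ Icc a b, s ≤ t →
        |coeff k (increment α β (S s) (S t))| ≤ C * ω s t ^ ((k + 1) / p) := by
  induction k using Nat.strong_induction_on with
  | _ k ih =>
    rcases le_or_gt (k + 1 : ℝ) p with hk | hk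
    · refine ⟨1, zero_le_one, fun ω a b S hS s hs t ht hst => ?_⟩
      rw [one_mul]
      exact hS.increment_le k hk s hs t ht hst
    choose! C hC hbound using ih
    have hθ : 1 < (k + 1) / p := (one_lt_div hp).2 hk
    have hK : 0 ≤ ∑ j ∈ Finset.range k, C j :=
      Finset.sum_nonneg fun j hj => hC j (Finset.mem_range.1 hj)
    refine ⟨(∑ j ∈ Finset.range k, C j) * sewingConst ((k + 1) / p),
      mul_nonneg hK (sewingConst_nonneg hθ), fun ω a b S hS s hs t ht hst => ?_⟩
    have hsub : Icc s t ⊆ Icc a b := Icc_subset_Icc hs.1 ht.2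
    have hω := hS.isControlOn
    rw [mul_assoc]
    refine sewing (Y := fun a b => coeff k (increment α β (S a) (S b))) hθ hK (hω.mono hsub) ?_
      (fun c => by simp only [increment_self, map_zero]) (hS.small_sums k hk s hs t ht hst)
    intro c hc d hd e he hcd hde
    have hmono : ∀ {x y r : ℝ}, 0 ≤ x → x ≤ y → 0 ≤ r → x ^ r ≤ y ^ r := Real.rpow_le_rpow
    refine abs_chen_defect_le hp (hω.nonneg c (hsub hc) e (hsub he) (hcd.trans hde)) ?_
      fun j hj => ?_
    · exact (hS.levelOne_le c (hsub hc) d (hsub hd) hcd).trans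
        (hmono (hω.nonneg c (hsub hc) d (hsub hd) hcd)
          (hω.left_le (hsub hc) (hsub hd) (hsub he) hcd hde) (by positivity))
    · exact (hbound j hj ω a b S hS d (hsub hd) e (hsub he) hde).trans
        (mul_le_mul_of_nonneg_left (hmono (hω.nonneg d (hsub hd) e (hsub he) hde)
          (hω.right_le (hsub hc) (hsub hd) (hsub he) hcd hde) (by positivity)) (hC j hj))

variable {V : Type*} [NormedAddCommGroup V] [InnerProductSpace ℝ V]

/-- The `p`-th power of the `p`-variation on `[s, t]` of a path in `G^{(n)}`. -/
def pVarControl {n : ℕ} (p : ℝ) (X : ℝ → TruncTensor V n) (s t : ℝ) : ℝ≥0∞ :=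
  control (fun a b => ccDist n (X a) (X b) ^ p) s t

theorem pVar_eq_pVarControl_rpow {n : ℕ} (p T : ℝ) (X : ℝ → TruncTensor V n) :
    pVar p T n X = pVarControl p X 0 T ^ (1 / p) :=
  rfl

theorem pVar_lt_top_iff {n : ℕ} {p T : ℝ} (hp : 0 < p) {X : ℝ → TruncTensor V n} :
    pVar p T n X < ∞ ↔ pVarControl p X 0 T < ∞ := by
  rw [pVar_eq_pVarControl_rpow, ENNReal.rpow_lt_top_iff_of_pos (by positivity)]

theorem IsPVarPath.mono {n : ℕ} {p q T : ℝ} (hp : 0 < p) (hpq : p ≤ q)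
    {X : ℝ → TruncTensor V n} (hX : IsPVarPath p T n X) : IsPVarPath q T n X where
  mem_group := hX.mem_group
  start := hX.start
  continuous := hX.continuous
  finite_pVar := (pVar_lt_top_iff (hp.trans_le hpq)).2
    (control_rpow_lt_top hp hpq ((pVar_lt_top_iff hp).1 hX.finite_pVar))

theorem signaturesOf_mono {p q : ℝ} (hp : 0 < p) (hpq : p ≤ q) (T : ℝ) :
    signaturesOf V p T ⊆ signaturesOf V q T := by
  rintro g ⟨X, -, S, hS, hg⟩
  have hpath : ∀ n, IsPVarPath q T n fun t => trunc n (S t) := fun n =>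
    (hS.isPVarPath n).mono hp hpq
  exact ⟨fun t => trunc ⌊q⌋₊ (S t), hpath _, S,
    ⟨hS.mem_groupLike, hS.start, hpath, fun _ _ => rfl⟩, hg⟩

theorem signatures_eq_iUnion_nat (T : ℝ) :
    signatures V T = ⋃ n : ℕ, signaturesOf V (n + 1) T := by
  refine Subset.antisymm (iUnion₂_subset fun p hp => ?_) (iUnion_subset fun n => ?_)
  · exact subset_iUnion_of_subset ⌊p⌋₊
      (signaturesOf_mono (zero_lt_one.trans_le hp) (Nat.lt_floor_add_one p).le T)
  · exact subset_iUnion₂_of_subset (n + 1 : ℝ) (by simp) Subset.rfl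

variable {α β : V →ₗ[ℝ] ℝ} {p T : ℝ} {X : ℝ → TruncTensor V ⌊p⌋₊} {S : ℝ → TensorSeries V}

namespace IsLyonsLift

theorem continuousOn_levelOne (hα : ∀ v, |α v| ≤ ‖v‖) (hS : IsLyonsLift p T X S) :
    ContinuousOn (fun t => levelOne α (S t)) (Icc 0 T) := by
  intro s hs
  rw [ContinuousWithinAt, tendsto_iff_edist_tendsto_0]
  refine tendsto_of_tendsto_of_tendsto_of_le_of_le tendsto_const_nhds
    ((hS.isPVarPath 1).continuous s hs) (fun _ => zero_le) fun t => ?_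
  rw [edist_dist, Real.dist_eq]
  exact ofReal_abs_levelOne_sub_le hα (hS.mem_groupLike s hs) (S t) one_pos

theorem tendsto_coeff_increment (hα : ∀ v, |α v| ≤ ‖v‖) (hβ : ∀ v, |β v| ≤ ‖v‖)
    (hS : IsLyonsLift p T X S) (k : ℕ) {s : ℝ} (hs : s ∈ Icc 0 T) :
    Tendsto (fun t => coeff k (increment α β (S s) (S t))) (𝓝[Icc 0 T] s) (𝓝 0) := by
  have hpow := ENNReal.Tendsto.pow (n := k + 1) ((hS.isPVarPath (k + 1)).continuous s hs)
  rw [zero_pow k.succ_ne_zero] at hpow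
  rw [tendsto_iff_edist_tendsto_0]
  refine tendsto_of_tendsto_of_tendsto_of_le_of_le tendsto_const_nhds hpow
    (fun _ => zero_le) fun t => ?_
  rw [edist_dist, Real.dist_eq, sub_zero]
  exact ofReal_abs_coeff_increment_le hα hβ (hS.mem_groupLike s hs) (S t) k.lt_succ_self

theorem continuousOn_coeff_lastLetterSeries (hα : ∀ v, |α v| ≤ ‖v‖) (hβ : ∀ v, |β v| ≤ ‖v‖)
    (hS : IsLyonsLift p T X S) (k : ℕ) :
    ContinuousOn (fun t => coeff k (lastLetterSeries α β (S t))) (Icc 0 T) := by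
  intro s hs
  have hsub : Tendsto (fun t =>
      coeff k (rescale (levelOne α (S s)) (exp ℝ) * increment α β (S s) (S t)))
      (𝓝[Icc 0 T] s) (𝓝 0) := by
    simp only [PowerSeries.coeff_mul]
    simpa using tendsto_finsetSum (Finset.HasAntidiagonal.antidiagonal k) fun ij _ =>
      (hS.tendsto_coeff_increment hα hβ ij.2 hs).const_mul
        (coeff ij.1 (rescale (levelOne α (S s)) (exp ℝ)))
  simp only [← lastLetterSeries_sub, map_sub] at hsub
  exact tendsto_sub_nhds_zero_iff.1 hsub

theorem continuousOn_coeff_increment (hα : ∀ v, |α v| ≤ ‖v‖) (hβ : ∀ v, |β v| ≤ ‖v‖)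
    (hS : IsLyonsLift p T X S) (k : ℕ) :
    ContinuousOn (fun z : ℝ × ℝ => coeff k (increment α β (S z.1) (S z.2)))
      (Icc 0 T ×ˢ Icc 0 T) := by
  have hfst : MapsTo (Prod.fst : ℝ × ℝ → ℝ) (Icc 0 T ×ˢ Icc 0 T) (Icc 0 T) := fun _ hz => hz.1
  have hsnd : MapsTo (Prod.snd : ℝ × ℝ → ℝ) (Icc 0 T ×ˢ Icc 0 T) (Icc 0 T) := fun _ hz => hz.2
  have hlast := hS.continuousOn_coeff_lastLetterSeries hα hβ
  simp only [increment, PowerSeries.coeff_mul, coeff_rescale_exp, map_sub]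
  refine continuousOn_finsetSum _ fun ij _ => ContinuousOn.mul ?_ (ContinuousOn.sub ?_ ?_)
  · exact (((hS.continuousOn_levelOne hα).comp continuousOn_fst hfst).neg.pow _).div_const _
  · exact (hlast ij.2).comp continuousOn_snd hsnd
  · exact (hlast ij.2).comp continuousOn_fst hfst

theorem hasSmallPartitionSums_coeff_increment (hα : ∀ v, |α v| ≤ ‖v‖) (hβ : ∀ v, |β v| ≤ ‖v‖)
    (hp : 0 < p) (hS : IsLyonsLift p T X S) {k : ℕ} (hk : p < k + 1) {s t : ℝ}
    (hs : s ∈ Icc 0 T) (ht : t ∈ Icc 0 T) (hst : s ≤ t) :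
    HasSmallPartitionSums (fun a b => coeff k (increment α β (S a) (S b))) s t := by
  have hsub : Icc s t ⊆ Icc 0 T := Icc_subset_Icc hs.1 ht.2
  have hfin : pVarControl p (fun t => trunc (k + 1) (S t)) s t < ∞ :=
    (control_mono _ hs.1 ht.2).trans_lt ((pVar_lt_top_iff hp).1 (hS.isPVarPath (k + 1)).finite_pVar)
  have hle : ∀ a ∈ Icc s t, ∀ b, ENNReal.ofReal (‖coeff k (increment α β (S a) (S b))‖ ^
      (p / (k + 1))) ≤ ccDist (k + 1) (trunc (k + 1) (S a)) (trunc (k + 1) (S b)) ^ p := by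
    intro a ha b
    rw [← ENNReal.ofReal_rpow_of_nonneg (norm_nonneg _) (by positivity)]
    refine (ENNReal.rpow_le_rpow (ofReal_abs_coeff_increment_le hα hβ
      (hS.mem_groupLike a (hsub ha)) (S b) k.lt_succ_self) (by positivity)).trans_eq ?_
    rw [← ENNReal.rpow_natCast, ← ENNReal.rpow_mul, Nat.cast_succ,
      mul_div_cancel₀ _ (by positivity)]
  refine hasSmallPartitionSums_of_sum_rpow_le hst ((div_lt_one (hp.trans hk)).2 hk)
    ((hS.continuousOn_coeff_increment hα hβ k).mono (prod_mono hsub hsub))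
    (fun a => by simp only [increment_self, map_zero])
    (W := (pVarControl p (fun t => trunc (k + 1) (S t)) s t).toReal) fun τ m hτ hmem => ?_
  rw [← ENNReal.ofReal_le_iff_le_toReal hfin.ne,
    ENNReal.ofReal_sum_of_nonneg fun i _ => by positivity]
  exact (Finset.sum_le_sum fun i _ => hle _ (hmem i) _).trans (sum_le_control _ hτ hmem m)

theorem isControlled (hα : ∀ v, |α v| ≤ ‖v‖) (hβ : ∀ v, |β v| ≤ ‖v‖) (hp : 1 ≤ p)
    (hS : IsLyonsLift p T X S) :
    IsControlled α β p (fun s t => (pVarControl p (fun t => trunc ⌊p⌋₊ (S t)) s t).toReal)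
      (Icc 0 T) S := by
  have hp0 : 0 < p := zero_lt_one.trans_le hp
  have hfin : pVarControl p (fun t => trunc ⌊p⌋₊ (S t)) 0 T < ∞ :=
    (pVar_lt_top_iff hp0).1 (hS.isPVarPath ⌊p⌋₊).finite_pVar
  have hbound : ∀ {y : ℝ} {m : ℕ} {s t : ℝ}, s ∈ Icc 0 T → t ∈ Icc 0 T → s ≤ t →
      ENNReal.ofReal y ≤ ccDist ⌊p⌋₊ (trunc ⌊p⌋₊ (S s)) (trunc ⌊p⌋₊ (S t)) ^ m →
      y ≤ (pVarControl p (fun t => trunc ⌊p⌋₊ (S t)) s t).toReal ^ ((m : ℝ) / p) :=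
    fun hs ht hst hy => le_toReal_rpow_div hp0 hy (le_control (fun a b =>
      ccDist ⌊p⌋₊ (trunc ⌊p⌋₊ (S a)) (trunc ⌊p⌋₊ (S b)) ^ p) hst)
      ((control_mono _ hs.1 ht.2).trans_lt hfin).ne
  refine ⟨isControlOn_toReal_control hfin, fun s hs t ht hst => ?_, fun k hk s hs t ht hst => ?_,
    fun k hk s hs t ht hst => hS.hasSmallPartitionSums_coeff_increment hα hβ hp0 hk hs ht hst⟩
  · have hlevel := ofReal_abs_levelOne_sub_le hα (hS.mem_groupLike s hs) (S t)
      (Nat.floor_pos.2 hp)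
    simpa using hbound (m := 1) hs ht hst (by simpa using hlevel)
  · have hkp : k < ⌊p⌋₊ := Nat.le_floor (by push_cast; exact hk)
    exact_mod_cast hbound hs ht hst
      (ofReal_abs_coeff_increment_le hα hβ (hS.mem_groupLike s hs) (S t) hkp)

end IsLyonsLift

theorem coeff_increment_unitSeries (α β : V →ₗ[ℝ] ℝ) (g : TensorSeries V) (k : ℕ) :
    coeff k (increment α β (unitSeries V) g) = lastLetter α β (g (k + 1)) := by
  have hlevel : levelOne α (unitSeries V) = 0 := map_zero _
  have hlast : lastLetterSeries α β (unitSeries V) = 0 := by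
    ext j
    exact (PowerSeries.coeff_mk _ _).trans (map_zero _)
  rw [increment, hlevel, hlast, neg_zero, rescale_exp_zero, one_mul, sub_zero, lastLetterSeries,
    PowerSeries.coeff_mk]

theorem exists_growth_bound_signaturesOf (hα : ∀ v, |α v| ≤ ‖v‖) (hβ : ∀ v, |β v| ≤ ‖v‖)
    (hp : 1 ≤ p) (hT : 0 ≤ T) :
    ∃ C : ℕ → ℝ, (∀ k, 0 ≤ C k) ∧ ∀ g ∈ signaturesOf V p T, ∃ w ≥ 0, ∀ k,
      |lastLetter α β (g (k + 1))| ≤ C k * w ^ ((k + 1) / p) := by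
  choose C hC hbound using
    exists_coeff_increment_bound (ι := ℝ) α β (zero_lt_one.trans_le hp)
  refine ⟨C, hC, ?_⟩
  rintro g ⟨X, -, S, hS, rfl⟩
  refine ⟨(pVarControl p (fun t => trunc ⌊p⌋₊ (S t)) 0 T).toReal, ENNReal.toReal_nonneg,
    fun k => ?_⟩
  rw [← coeff_increment_unitSeries, ← hS.start]
  exact hbound k _ 0 T S (hS.isControlled hα hβ hp) 0 (left_mem_Icc.2 hT) T (right_mem_Icc.2 hT) hT

theorem exists_countable_growth_bounds (hα : ∀ v, |α v| ≤ ‖v‖) (hβ : ∀ v, |β v| ≤ ‖v‖)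
    (hT : 0 ≤ T) :
    ∃ C : ℕ × ℕ → ℕ → ℝ, ∀ g ∈ signatures V T, ∃ i, ∀ k,
      |lastLetter α β (g (k + 1))| ≤ C i k := by
  choose C hC hbound using fun n : ℕ =>
    exists_growth_bound_signaturesOf hα hβ (p := n + 1) (by simp) hT
  refine ⟨fun i k => C i.1 k * (i.2 : ℝ) ^ (((k : ℝ) + 1) / (i.1 + 1)), fun g hg => ?_⟩
  rw [signatures_eq_iUnion_nat] at hg
  obtain ⟨n, hgn⟩ := mem_iUnion.1 hg
  obtain ⟨w, hw, hwbound⟩ := hbound n g hgn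
  obtain ⟨N, hN⟩ := exists_nat_ge w
  exact ⟨(n, N), fun k => (hwbound k).trans
    (mul_le_mul_of_nonneg_left (Real.rpow_le_rpow hw hN (by positivity)) (hC n k))⟩

end Lift

section ExpMonomial

variable {A : Type*} [Ring A] [Algebra ℝ A]

/-- The exponential `∑ₖ aᵏ Xᵐᵏ / k!` of `a Xᵐ`, for `m > 0`; the coefficients need not commute. -/
def expMonomial (m : ℕ) (a : A) : PowerSeries A :=
  PowerSeries.mk fun n => if m ∣ n then ((n / m).factorial : ℝ)⁻¹ • a ^ (n / m) else 0

theorem coeff_expMonomial_mul {m : ℕ} (hm : 0 < m) (a : A) (q : ℕ) :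
    coeff (m * q) (expMonomial m a) = (q.factorial : ℝ)⁻¹ • a ^ q := by
  rw [expMonomial, PowerSeries.coeff_mk, if_pos (dvd_mul_right m q), Nat.mul_div_cancel_left q hm]

theorem coeff_expMonomial_of_not_dvd {m n : ℕ} (hmn : ¬ m ∣ n) (a : A) :
    coeff n (expMonomial m a) = 0 := by
  rw [expMonomial, PowerSeries.coeff_mk, if_neg hmn]

theorem coeff_expMonomial_of_le {m j : ℕ} (hm : 0 < m) (hj : j ≤ m) (a : A) :
    coeff j (expMonomial m a) = coeff j (1 + PowerSeries.C a * PowerSeries.X ^ m) := by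
  rw [map_add, PowerSeries.coeff_one, PowerSeries.coeff_C_mul_X_pow]
  rcases j.eq_zero_or_pos with rfl | hj0
  · simpa [hm.ne] using coeff_expMonomial_mul hm a 0
  rcases hj.eq_or_lt with rfl | hjm
  · simpa [hm.ne'] using coeff_expMonomial_mul hm a 1
  · rw [coeff_expMonomial_of_not_dvd (Nat.not_dvd_of_pos_of_lt hj0 hjm), if_neg hj0.ne',
      if_neg hjm.ne, add_zero]

theorem coeff_mul_expMonomial_of_le {m i : ℕ} (hm : 0 < m) (hi : i ≤ m) (F : PowerSeries A)
    (a : A) : coeff i (F * expMonomial m a) =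
      coeff i F + if i = m then coeff 0 F * a else 0 := by
  have hcongr : coeff i (F * expMonomial m a) =
      coeff i (F * (1 + PowerSeries.C a * PowerSeries.X ^ m)) := by
    simp only [PowerSeries.coeff_mul]
    exact Finset.sum_congr rfl fun ij hij => by
      rw [coeff_expMonomial_of_le hm
        ((Finset.HasAntidiagonal.antidiagonal.snd_le hij).trans hi)]
  rw [hcongr, mul_add, mul_one, map_add, ← mul_assoc, PowerSeries.coeff_mul_X_pow']
  rcases hi.eq_or_lt with rfl | him
  · simp only [le_refl, if_true, Nat.sub_self, PowerSeries.coeff_mul_C]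
  · rw [if_neg him.not_ge, if_neg him.ne]

theorem sum_antidiagonal_mul_eq {M : Type*} [AddCommMonoid M] {m : ℕ} (hm : 0 < m) (q : ℕ)
    {f : ℕ × ℕ → M} (hf : ∀ ij : ℕ × ℕ, ¬ m ∣ ij.1 → f ij = 0) :
    ∑ ij ∈ Finset.HasAntidiagonal.antidiagonal (m * q), f ij =
      ∑ ij ∈ Finset.HasAntidiagonal.antidiagonal q, f (m * ij.1, m * ij.2) := by
  refine (Finset.sum_of_injOn (fun ij : ℕ × ℕ => (m * ij.1, m * ij.2)) ?_ ?_ ?_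
    fun _ _ => rfl).symm
  · rintro ⟨i, j⟩ - ⟨i', j'⟩ - h
    simpa [hm.ne'] using h
  · intro ij hij
    rw [Finset.mem_coe, Finset.HasAntidiagonal.mem_antidiagonal] at hij ⊢
    rw [← mul_add, hij]
  · rintro ⟨i, j⟩ hij hnot
    refine hf _ ?_
    rintro ⟨i', rfl⟩
    rw [Finset.HasAntidiagonal.mem_antidiagonal] at hij
    obtain ⟨j', rfl⟩ : m ∣ j := (Nat.dvd_add_right (dvd_mul_right m i')).1 ⟨q, hij⟩
    refine hnot ⟨(i', j'), ?_, rfl⟩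
    rw [Finset.mem_coe, Finset.HasAntidiagonal.mem_antidiagonal]
    exact Nat.eq_of_mul_eq_mul_left hm (by rw [mul_add]; exact hij)

theorem expMonomial_add {m : ℕ} (hm : 0 < m) {a b : A} (hab : Commute a b) :
    expMonomial m (a + b) = expMonomial m a * expMonomial m b := by
  ext n
  rw [PowerSeries.coeff_mul]
  by_cases hmn : m ∣ n
  · obtain ⟨q, rfl⟩ := hmn
    rw [coeff_expMonomial_mul hm, sum_antidiagonal_mul_eq hm q fun ij hi => by
      rw [coeff_expMonomial_of_not_dvd hi, zero_mul], hab.add_pow' q, Finset.smul_sum]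
    refine Finset.sum_congr rfl fun ⟨i, j⟩ hij => ?_
    obtain rfl : i + j = q := Finset.HasAntidiagonal.mem_antidiagonal.1 hij
    rw [coeff_expMonomial_mul hm, coeff_expMonomial_mul hm, smul_mul_smul_comm,
      ← Nat.cast_smul_eq_nsmul ℝ, smul_smul, Nat.cast_add_choose]
    congr 1
    field_simp
  · rw [coeff_expMonomial_of_not_dvd hmn, Finset.sum_eq_zero]
    intro ij hij
    rw [Finset.HasAntidiagonal.mem_antidiagonal] at hij
    by_cases hi : m ∣ ij.1
    · rw [coeff_expMonomial_of_not_dvd fun hj => hmn (hij ▸ dvd_add hi hj), mul_zero]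
    · rw [coeff_expMonomial_of_not_dvd hi, zero_mul]

theorem map_expMonomial {B : Type*} [Ring B] [Algebra ℝ B] (f : A →ₐ[ℝ] B) (m : ℕ) (a : A) :
    PowerSeries.map (f : A →+* B) (expMonomial m a) = expMonomial m (f a) := by
  ext n
  simp only [expMonomial, PowerSeries.coeff_map, PowerSeries.coeff_mk]
  split_ifs <;> simp

end ExpMonomial

section Perturbation

variable {V : Type*} [AddCommGroup V] [Module ℝ V]

/-- The tensor square of the tensor algebra. -/
abbrev TensorSquare (V : Type*) [AddCommGroup V] [Module ℝ V] : Type _ :=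
  TensorAlgebra ℝ V ⊗[ℝ] TensorAlgebra ℝ V

/-- The inclusion `x ↦ x ⊗ 1` of the tensor algebra in its tensor square. -/
abbrev inclLeft (V : Type*) [AddCommGroup V] [Module ℝ V] :
    TensorAlgebra ℝ V →ₐ[ℝ] TensorSquare V :=
  Algebra.TensorProduct.includeLeft

/-- The inclusion `x ↦ 1 ⊗ x` of the tensor algebra in its tensor square. -/
abbrev inclRight (V : Type*) [AddCommGroup V] [Module ℝ V] :
    TensorAlgebra ℝ V →ₐ[ℝ] TensorSquare V :=
  Algebra.TensorProduct.includeRight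

theorem inclLeft_commute_inclRight (x y : TensorAlgebra ℝ V) :
    Commute (inclLeft V x) (inclRight V y) := by
  simp [Commute, SemiconjBy]

/-- A tensor series as a power series, the exponent of the variable being the degree. -/
def toPowerSeries (g : TensorSeries V) : PowerSeries (TensorAlgebra ℝ V) :=
  PowerSeries.mk fun n => (g n : TensorAlgebra ℝ V)

theorem coeff_toPowerSeries (g : TensorSeries V) (n : ℕ) : coeff n (toPowerSeries g) = g n :=
  PowerSeries.coeff_mk n _

theorem exists_toPowerSeries_eq {F : PowerSeries (TensorAlgebra ℝ V)}
    (hF : ∀ n, coeff n F ∈ TPow V n) : ∃ g : TensorSeries V, toPowerSeries g = F :=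
  ⟨fun n => ⟨coeff n F, hF n⟩, PowerSeries.ext fun n => coeff_toPowerSeries _ n⟩

/-- The identity `Δ F = F ⊗ F` for power series with coefficients in the tensor algebra, `Δ` being
applied coefficientwise. -/
def IsGroupLikeSeries (F : PowerSeries (TensorAlgebra ℝ V)) : Prop :=
  PowerSeries.map (coproduct V : TensorAlgebra ℝ V →+* TensorSquare V) F =
    PowerSeries.map (inclLeft V : TensorAlgebra ℝ V →+* TensorSquare V) F *
      PowerSeries.map (inclRight V : TensorAlgebra ℝ V →+* TensorSquare V) F

theorem mem_groupLike_iff (g : TensorSeries V) :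
    g ∈ groupLike V ↔ (g 0 : TensorAlgebra ℝ V) = 1 ∧ IsGroupLikeSeries (toPowerSeries g) := by
  refine and_congr Iff.rfl ?_
  rw [IsGroupLikeSeries, PowerSeries.ext_iff]
  refine forall_congr' fun n => ?_
  simp [PowerSeries.coeff_mul, coeff_toPowerSeries]

theorem IsGroupLikeSeries.one : IsGroupLikeSeries (1 : PowerSeries (TensorAlgebra ℝ V)) := by
  simp only [IsGroupLikeSeries, map_one, mul_one]

theorem IsGroupLikeSeries.mul {F G : PowerSeries (TensorAlgebra ℝ V)} (hF : IsGroupLikeSeries F)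
    (hG : IsGroupLikeSeries G) : IsGroupLikeSeries (F * G) := by
  have hcomm : PowerSeries.map (inclLeft V : TensorAlgebra ℝ V →+* TensorSquare V) G *
      PowerSeries.map (inclRight V : TensorAlgebra ℝ V →+* TensorSquare V) F =
      PowerSeries.map (inclRight V : TensorAlgebra ℝ V →+* TensorSquare V) F *
        PowerSeries.map (inclLeft V : TensorAlgebra ℝ V →+* TensorSquare V) G := by
    ext n
    rw [PowerSeries.coeff_mul, PowerSeries.coeff_mul, ← Finset.Nat.sum_antidiagonal_swap]
    refine Finset.sum_congr rfl fun ij _ => ?_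
    simp only [PowerSeries.coeff_map, Prod.fst_swap, Prod.snd_swap]
    exact inclLeft_commute_inclRight _ _
  rw [IsGroupLikeSeries] at *
  rw [map_mul, map_mul, map_mul, hF, hG, mul_assoc, mul_assoc]
  congr 1
  rw [← mul_assoc, ← mul_assoc, hcomm]

theorem unitSeries_mem_groupLike : unitSeries V ∈ groupLike V := by
  have hone : toPowerSeries (unitSeries V) = 1 := by
    ext n
    rw [coeff_toPowerSeries, PowerSeries.coeff_one]
    cases n <;> rfl
  exact (mem_groupLike_iff _).2 ⟨rfl, hone ▸ IsGroupLikeSeries.one⟩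

/-- Primitive elements of the tensor algebra, `Δ z = z ⊗ 1 + 1 ⊗ z`. -/
def IsPrimitiveTensor (z : TensorAlgebra ℝ V) : Prop :=
  coproduct V z = inclLeft V z + inclRight V z

namespace IsPrimitiveTensor

theorem ι (v : V) : IsPrimitiveTensor (TensorAlgebra.ι ℝ v) := by
  simp [IsPrimitiveTensor, coproduct]

theorem commutator {x y : TensorAlgebra ℝ V} (hx : IsPrimitiveTensor x)
    (hy : IsPrimitiveTensor y) : IsPrimitiveTensor (x * y - y * x) := by
  have hxy := (inclLeft_commute_inclRight x y).eq
  have hyx := (inclLeft_commute_inclRight y x).eq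
  rw [IsPrimitiveTensor] at *
  simp only [map_sub, map_mul, hx, hy, add_mul, mul_add, hxy, hyx]
  abel

theorem smul {x : TensorAlgebra ℝ V} (hx : IsPrimitiveTensor x) (c : ℝ) :
    IsPrimitiveTensor (c • x) := by
  rw [IsPrimitiveTensor] at *
  rw [map_smul, map_smul, map_smul, hx, smul_add]

theorem isGroupLikeSeries_expMonomial {z : TensorAlgebra ℝ V} (hz : IsPrimitiveTensor z) {m : ℕ}
    (hm : 0 < m) : IsGroupLikeSeries (expMonomial m z) := by
  rw [IsGroupLikeSeries, map_expMonomial, map_expMonomial, map_expMonomial, hz,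
    expMonomial_add hm (inclLeft_commute_inclRight z z)]

end IsPrimitiveTensor

theorem coeff_expMonomial_mem_TPow {m : ℕ} {z : TensorAlgebra ℝ V} (hz : z ∈ TPow V m) (n : ℕ) :
    coeff n (expMonomial m z) ∈ TPow V n := by
  rw [expMonomial, PowerSeries.coeff_mk]
  split_ifs with hmn
  · have hpow := Submodule.pow_mem_pow _ hz (n / m)
    rw [← pow_mul, Nat.mul_div_cancel' hmn] at hpow
    exact Submodule.smul_mem _ _ hpow
  · exact Submodule.zero_mem _

theorem coeff_mul_mem_TPow {F G : PowerSeries (TensorAlgebra ℝ V)}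
    (hF : ∀ n, coeff n F ∈ TPow V n) (hG : ∀ n, coeff n G ∈ TPow V n) (n : ℕ) :
    coeff n (F * G) ∈ TPow V n := by
  rw [PowerSeries.coeff_mul]
  refine Submodule.sum_mem _ fun ij hij => ?_
  rw [← Finset.HasAntidiagonal.mem_antidiagonal.1 hij, TPow, pow_add]
  exact Submodule.mul_mem_mul (hF ij.1) (hG ij.2)

theorem exists_groupLike_add_primitive {g : TensorSeries V} (hg : g ∈ groupLike V) {m : ℕ}
    (hm : 0 < m) {z : TensorAlgebra ℝ V} (hz : z ∈ TPow V m) (hprim : IsPrimitiveTensor z) :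
    ∃ h ∈ groupLike V, (∀ i < m, h i = g i) ∧ (h m : TensorAlgebra ℝ V) = g m + z := by
  obtain ⟨h, hh⟩ := exists_toPowerSeries_eq
    (coeff_mul_mem_TPow (F := toPowerSeries g) (fun n => (coeff_toPowerSeries g n).symm ▸ (g n).2)
      (coeff_expMonomial_mem_TPow hz))
  have hcoeff : ∀ i ≤ m, (h i : TensorAlgebra ℝ V) = g i + if i = m then z else 0 := by
    intro i hi
    rw [← coeff_toPowerSeries, hh, coeff_mul_expMonomial_of_le hm hi, coeff_toPowerSeries,
      coeff_toPowerSeries, hg.1, one_mul]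
  have hlow : ∀ i < m, h i = g i := fun i hi => Subtype.ext <| by
    rw [hcoeff i hi.le, if_neg hi.ne, add_zero]
  refine ⟨h, (mem_groupLike_iff h).2 ⟨hlow 0 hm ▸ hg.1, ?_⟩, hlow, by simpa using hcoeff m le_rfl⟩
  rw [hh]
  exact ((mem_groupLike_iff g).1 hg).2.mul (hprim.isGroupLikeSeries_expMonomial hm)

/-- The iterated commutator `[a, [a, … [a, b]]]` with `k` letters `a`. -/
def iteratedCommutator (a b : V) : ℕ → TensorAlgebra ℝ V
  | 0 => TensorAlgebra.ι ℝ b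
  | k + 1 => TensorAlgebra.ι ℝ a * iteratedCommutator a b k -
      iteratedCommutator a b k * TensorAlgebra.ι ℝ a

theorem isPrimitiveTensor_iteratedCommutator (a b : V) (k : ℕ) :
    IsPrimitiveTensor (iteratedCommutator a b k) := by
  induction k with
  | zero => exact .ι b
  | succ k ih => exact (IsPrimitiveTensor.ι a).commutator ih

theorem iteratedCommutator_mem_TPow (a b : V) (k : ℕ) :
    iteratedCommutator a b k ∈ TPow V (k + 1) := by
  induction k with
  | zero =>
    rw [TPow, zero_add, pow_one]
    exact LinearMap.mem_range_self _ b
  | succ k ih =>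
    have ha : TensorAlgebra.ι ℝ a ∈ LinearMap.range (TensorAlgebra.ι ℝ : V →ₗ[ℝ] _) :=
      LinearMap.mem_range_self _ a
    refine Submodule.sub_mem _ ?_ ?_
    · rw [TPow, pow_succ']
      exact Submodule.mul_mem_mul ha ih
    · rw [TPow, pow_succ]
      exact Submodule.mul_mem_mul ih ha

variable {α β : V →ₗ[ℝ] ℝ} {a b : V}

theorem lastLetter_iteratedCommutator (haα : α a = 1) (haβ : β a = 0) (hbβ : β b = 1) (k : ℕ) :
    lastLetter α β (iteratedCommutator a b k) = 1 := by
  induction k with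
  | zero => rw [iteratedCommutator, lastLetter_ι, hbβ]
  | succ k ih => rw [iteratedCommutator, lastLetter_commutator α β haα haβ, ih]

theorem exists_groupLike_lt_abs_lastLetter (haα : α a = 1) (haβ : β a = 0) (hbβ : β b = 1)
    {g : TensorSeries V} (hg : g ∈ groupLike V) (k : ℕ) (M : ℝ) :
    ∃ h ∈ groupLike V, (∀ i ≤ k, h i = g i) ∧ M < |lastLetter α β (h (k + 1))| := by
  set c : ℝ := M + 1 - lastLetter α β (g (k + 1)) with hc
  obtain ⟨h, hh, hlow, htop⟩ := exists_groupLike_add_primitive hg k.succ_pos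
    (Submodule.smul_mem _ c (iteratedCommutator_mem_TPow a b k))
    ((isPrimitiveTensor_iteratedCommutator a b k).smul c)
  refine ⟨h, hh, fun i hi => hlow i (Nat.lt_succ_of_le hi), ?_⟩
  rw [htop, map_add, map_smul, lastLetter_iteratedCommutator haα haβ hbβ, hc, smul_eq_mul,
    mul_one, add_sub_cancel]
  exact (lt_add_one M).trans_le (le_abs_self _)

theorem diagonal_mem_groupLike {H : ℕ → TensorSeries V} (hH : ∀ n, H n ∈ groupLike V)
    (hstep : ∀ n, ∀ i ≤ n, H (n + 1) i = H n i) : (fun n => H n n) ∈ groupLike V := by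
  have hstable : ∀ {i n}, i ≤ n → H n i = H i i := fun {i n} hi => by
    induction n, hi using Nat.le_induction with
    | base => rfl
    | succ n hi ih => rw [hstep n i hi, ih]
  refine ⟨(hH 0).1, fun n => ?_⟩
  rw [(hH n).2 n]
  refine Finset.sum_congr rfl fun ij hij => ?_
  rw [hstable (Finset.HasAntidiagonal.antidiagonal.fst_le hij),
    hstable (Finset.HasAntidiagonal.antidiagonal.snd_le hij)]

theorem exists_groupLike_forall_lt_abs_lastLetter (haα : α a = 1) (haβ : β a = 0)
    (hbβ : β b = 1) (M : ℕ → ℝ) :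
    ∃ g ∈ groupLike V, ∀ k, M k < |lastLetter α β (g (k + 1))| := by
  choose next hnext hlow hbig using fun (g : groupLike V) (k : ℕ) =>
    exists_groupLike_lt_abs_lastLetter haα haβ hbβ g.2 k (M k)
  let H : ℕ → groupLike V :=
    Nat.rec ⟨unitSeries V, unitSeries_mem_groupLike⟩ fun k g => ⟨next g k, hnext g k⟩
  exact ⟨fun n => (H n).1 n, diagonal_mem_groupLike (fun n => (H n).2) fun n => hlow (H n) n,
    fun k => hbig (H k) k⟩

theorem exists_groupLike_not_le_growth {ι : Type*} [Nonempty ι] [Countable ι] (haα : α a = 1)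
    (haβ : β a = 0) (hbβ : β b = 1) (C : ι → ℕ → ℝ) :
    ∃ g ∈ groupLike V, ∀ i, ∃ k, C i k < |lastLetter α β (g (k + 1))| := by
  obtain ⟨e, he⟩ := exists_surjective_nat ι
  obtain ⟨g, hg, hlarge⟩ :=
    exists_groupLike_forall_lt_abs_lastLetter haα haβ hbβ fun k => C (e k) k
  refine ⟨g, hg, fun i => ?_⟩
  obtain ⟨k, rfl⟩ := he i
  exact ⟨k, hlarge k⟩

end Perturbation

section Meagre

variable {V : Type*} [AddCommGroup V] [Module ℝ V]

theorem continuous_dual_apply (ℓ : Module.Dual ℝ (TensorAlgebra ℝ V)) (n : ℕ) :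
    Continuous fun g : TensorSeries V => ℓ (g n) := by
  have : IsModuleTopology ℝ (TPow V n) := ⟨rfl⟩
  have hℓ : Continuous (ℓ ∘ₗ (TPow V n).subtype) := IsModuleTopology.continuous_of_linearMap _
  exact hℓ.comp (continuous_apply n)

variable {α β : V →ₗ[ℝ] ℝ} {a b : V}

theorem isClosed_growth_bound (α β : V →ₗ[ℝ] ℝ) (C : ℕ → ℝ) :
    IsClosed {g : groupLike V | ∀ k, |lastLetter α β (g.1 (k + 1))| ≤ C k} := by
  simp only [ofPred_forall]
  exact isClosed_iInter fun k => isClosed_le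
    ((continuous_dual_apply _ _).comp continuous_subtype_val).abs continuous_const

theorem dense_compl_growth_bound (haα : α a = 1) (haβ : β a = 0) (hbβ : β b = 1) (C : ℕ → ℝ) :
    Dense {g : groupLike V | ∀ k, |lastLetter α β (g.1 (k + 1))| ≤ C k}ᶜ := by
  rw [dense_iff_inter_open]
  rintro _ ⟨O, hO, rfl⟩ ⟨g, hgO⟩
  obtain ⟨I, u, hu, hIu⟩ := isOpen_pi_iff.1 hO g hgO
  obtain ⟨h, hh, hlow, hbig⟩ :=
    exists_groupLike_lt_abs_lastLetter haα haβ hbβ g.2 (I.sup id) (C (I.sup id))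
  refine ⟨⟨h, hh⟩, hIu fun i hi => ?_, fun hmem => hbig.not_ge (hmem _)⟩
  change h i ∈ u i
  rw [hlow i (Finset.le_sup (f := id) hi)]
  exact (hu i hi).2

theorem isMeagre_growth_bound (haα : α a = 1) (haβ : β a = 0) (hbβ : β b = 1) (C : ℕ → ℝ) :
    IsMeagre {g : groupLike V | ∀ k, |lastLetter α β (g.1 (k + 1))| ≤ C k} :=
  residual_of_dense_open (isClosed_growth_bound α β C).isOpen_compl
    (dense_compl_growth_bound haα haβ hbβ C)

end Meagre

theorem exists_coordinates {V : Type*} [NormedAddCommGroup V] [InnerProductSpace ℝ V]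
    (hV : 1 < Module.rank ℝ V) :
    ∃ (α β : V →ₗ[ℝ] ℝ) (a b : V), (∀ v, |α v| ≤ ‖v‖) ∧ (∀ v, |β v| ≤ ‖v‖) ∧
      α a = 1 ∧ β a = 0 ∧ β b = 1 := by
  have : Nontrivial V := rank_pos_iff_nontrivial.1 (zero_lt_one.trans hV)
  obtain ⟨x, hx⟩ := exists_ne (0 : V)
  obtain ⟨y, hxy⟩ := exists_linearIndependent_pair_of_one_lt_rank hV hx
  have he := InnerProductSpace.gramSchmidtNormed_orthonormal (𝕜 := ℝ) hxy
  set e := InnerProductSpace.gramSchmidtNormed ℝ ![x, y]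
  have hnorm : ∀ i v, |innerₛₗ ℝ (e i) v| ≤ ‖v‖ := fun i v => by
    simpa [he.1 i] using abs_real_inner_le_norm (e i) v
  exact ⟨innerₛₗ ℝ (e 0), innerₛₗ ℝ (e 1), e 0, e 1, hnorm 0, hnorm 1, by simp [he.1 0],
    by simpa using he.2 one_ne_zero, by simp [he.1 1]⟩

theorem signatures_subset_groupLike {V : Type*} [NormedAddCommGroup V] [InnerProductSpace ℝ V]
    {T : ℝ} (hT : 0 ≤ T) : signatures V T ⊆ groupLike V := by
  refine iUnion₂_subset fun p _ => ?_
  rintro g ⟨X, -, S, hS, rfl⟩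
  exact hS.mem_groupLike T (right_mem_Icc.2 hT)

end

end RoughPath

theorem mainTheorem10_general {V : Type*} [NormedAddCommGroup V] [InnerProductSpace ℝ V]
    (hV : 1 < Module.rank ℝ V) {T : ℝ} (hT : 0 ≤ T) :
    RoughPath.signatures V T ⊂ RoughPath.groupLike V ∧
      IsMeagre {g : RoughPath.groupLike V | (g : RoughPath.TensorSeries V) ∈
        RoughPath.signatures V T} := by
  obtain ⟨α, β, a, b, hα, hβ, haα, haβ, hbβ⟩ := RoughPath.exists_coordinates hV
  obtain ⟨C, hC⟩ := RoughPath.exists_countable_growth_bounds hα hβ hT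
  constructor
  · refine ⟨RoughPath.signatures_subset_groupLike hT, fun hsub => ?_⟩
    obtain ⟨g, hg, hlarge⟩ := RoughPath.exists_groupLike_not_le_growth haα haβ hbβ C
    obtain ⟨i, hi⟩ := hC g (hsub hg)
    obtain ⟨k, hk⟩ := hlarge i
    exact hk.not_ge (hi k)
  · exact (isMeagre_iUnion fun i => RoughPath.isMeagre_growth_bound haα haβ hbβ (C i)).mono
      fun g hg => Set.mem_iUnion.2 (hC g hg)

theorem mainTheorem10 {V : Type*} [NormedAddCommGroup V] [InnerProductSpace ℝ V]
    [FiniteDimensional ℝ V] (hV : 2 ≤ Module.finrank ℝ V) {T : ℝ} (hT : 0 < T) :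
    RoughPath.signatures V T ⊂ RoughPath.groupLike V ∧
      IsMeagre {g : RoughPath.groupLike V | (g : RoughPath.TensorSeries V) ∈
        RoughPath.signatures V T} :=
  mainTheorem10_general (Module.one_lt_rank_of_one_lt_finrank hV) hT.le
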